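/- There is an absolute constant $C>0$ such that the following holds for every dimension $d$ and every bounded convex domain (nonempty open convex bounded set) $\Omega\subset\mathbb{R}^d$. For every real-valued $v\in H^2(\Omega)$ and $j\in\{0,1\}$, $$\inf_{p\in\mathbb{P}_1(\Omega)} |v-p|_{H^j(\Omega)} \le C\,\operatorname{diam}(\Omega)^{2-j}\,|v|_{H^2(\Omega)} .$$ Here $\mathbb{P}_1(\Omega)$ is the space of affine functions (polynomials of degree at most one) on $\Omega$, and $|v|_{H^k(\Omega)}=\bigl(\sum_{|\alpha|=k}\|D^\alpha v\|_{L^2(\Omega)}^2\bigr)^{1/2}$ with weak derivatives $D^\alpha$, the sum being over multi-indices of order $k$; in particular $|v|_{H^0(\Omega)}=\|v\|_{L^2(\Omega)}$. The constant $C$ depends neither on $d$, $\Omega$, $v$ nor $j$. -/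

import Mathlib

open MeasureTheory
open scoped ContDiff

noncomputable section

/-- `g` is the weak derivative `∂_{s 0} ⋯ ∂_{s (k-1)} v` on the open set `Ω ⊆ ℝ^d`: both functions
are locally integrable on `Ω` and
`∫_Ω v ∂_{s 0} ⋯ ∂_{s (k-1)} φ = (-1)^k ∫_Ω g φ` for all `φ ∈ C_c^∞(Ω)`. -/
def HasWeakDeriv {d : ℕ} (Ω : Set (EuclideanSpace ℝ (Fin d))) {k : ℕ} (s : Fin k → Fin d)
    (v g : EuclideanSpace ℝ (Fin d) → ℝ) : Prop :=
  LocallyIntegrableOn v Ω volume ∧ LocallyIntegrableOn g Ω volume ∧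
    ∀ φ : EuclideanSpace ℝ (Fin d) → ℝ,
      ContDiff ℝ ∞ φ → HasCompactSupport φ → tsupport φ ⊆ Ω →
        ∫ x in Ω, v x * iteratedFDeriv ℝ k φ x (fun m => EuclideanSpace.single (s m) (1 : ℝ)) =
          (-1 : ℝ) ^ k * ∫ x in Ω, g x * φ x

/-- Weak derivatives on an open set are unique up to null sets. -/
theorem HasWeakDeriv.ae_eq {d : ℕ} {Ω : Set (EuclideanSpace ℝ (Fin d))} (hΩ : IsOpen Ω) {k : ℕ}
    {s : Fin k → Fin d} {v g₁ g₂ : EuclideanSpace ℝ (Fin d) → ℝ}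
    (h₁ : HasWeakDeriv Ω s v g₁) (h₂ : HasWeakDeriv Ω s v g₂) :
    g₁ =ᵐ[volume.restrict Ω] g₂ := by
  have key := hΩ.ae_eq_zero_of_integral_contDiff_smul_eq_zero (h₁.2.1.sub h₂.2.1) (μ := volume)
    (fun φ hφ hc hs => by
      have e := (h₁.2.2 φ hφ hc hs).symm.trans (h₂.2.2 φ hφ hc hs)
      have e' := mul_left_cancel₀ (pow_ne_zero k (by norm_num : (-1 : ℝ) ≠ 0)) e
      have i : ∀ g : EuclideanSpace ℝ (Fin d) → ℝ, LocallyIntegrableOn g Ω volume →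
          Integrable (fun x => g x * φ x) volume := by
        intro g hg
        have hi := (hg.integrableOn_compact_subset hs hc).mul_continuousOn
          hφ.continuous.continuousOn hc
        refine (integrableOn_iff_integrable_of_support_subset ?_).1 hi
        intro x hx
        exact subset_tsupport φ fun h0 => hx (by simp [h0])
      have r : ∀ g : EuclideanSpace ℝ (Fin d) → ℝ,
          ∫ x in Ω, g x * φ x = ∫ x, g x * φ x := by
        intro g
        refine setIntegral_eq_integral_of_forall_compl_eq_zero fun x hx => ?_
        rw [image_eq_zero_of_notMem_tsupport fun h => hx (hs h), mul_zero]
      rw [r, r] at e'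
      have : (fun x => φ x • (g₁ - g₂) x) = fun x => g₁ x * φ x - g₂ x * φ x := by
        funext x; simp; ring
      rw [this, integral_sub (i _ h₁.2.1) (i _ h₂.2.1), e', sub_self])
  refine (ae_restrict_iff' hΩ.measurableSet).2 (key.mono fun x hx hxΩ => ?_)
  exact sub_eq_zero.1 (hx hxΩ)

open Classical in
/-- A representative of the weak derivative `∂_{s 0} ⋯ ∂_{s (k-1)} v` on `Ω` (zero if there is
none). For open `Ω` it does not depend on the choice, up to null sets. -/
def weakDeriv {d : ℕ} (Ω : Set (EuclideanSpace ℝ (Fin d))) {k : ℕ} (s : Fin k → Fin d)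
    (v : EuclideanSpace ℝ (Fin d) → ℝ) : EuclideanSpace ℝ (Fin d) → ℝ :=
  if h : ∃ g, HasWeakDeriv Ω s v g then h.choose else 0

/-- `v ∈ H^k(Ω)`: all weak derivatives of order at most `k` (including order `0`, that is, `v`
itself) exist and lie in `L²(Ω)`. -/
def MemH {d : ℕ} (Ω : Set (EuclideanSpace ℝ (Fin d))) (k : ℕ)
    (v : EuclideanSpace ℝ (Fin d) → ℝ) : Prop :=
  ∀ j ≤ k, ∀ s : Fin j → Fin d, ∃ g, HasWeakDeriv Ω s v g ∧ MemLp g 2 (volume.restrict Ω)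

open Classical in
/-- The seminorm `|v|_{H^k(Ω)} = (∑_{|α| = k} ‖D^α v‖²_{L²(Ω)})^{1/2}`, the sum being over
multi-indices of order `k`. A multi-index `α` of order `k` is written as the nondecreasing
sequence of length `k` in which `i` occurs `α_i` times. For `k = 0` this is `‖v‖_{L²(Ω)}`. -/
def sobolevSeminorm {d : ℕ} (Ω : Set (EuclideanSpace ℝ (Fin d))) (k : ℕ)
    (v : EuclideanSpace ℝ (Fin d) → ℝ) : ℝ :=
  √(∑ s : Fin k → Fin d with Monotone s, ∫ x in Ω, weakDeriv Ω s v x ^ 2)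

end

/-! Everything rests on a Poincaré inequality on bounded convex sets,
`exists_integral_sub_sq_le_of_hasWeakDeriv`, whose constant is a multiple of the squared diameter
and free of the dimension. Applied to each first derivative of `v`, it gives numbers `a i`, hence a
linear `l` with gradient `a`; applied to `v - l`, it gives a constant `b`. The affine function `l +
b` serves both values of `j`. Adding the squared inequalities over all `i` loses no dimensional
factor.

The Poincaré inequality comes from Prékopa–Leindler, which has constant one in every dimension
because it tensorises. On a convex `A` in a ball of radius `D`, the weight `ρ = exp(-|x - x₀|²/D²)`
lies between `1/e` and `1`, and its strict log-concavity leaves room in the inequality (Maurey): `∫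
exp(p) ρ * ∫ exp(q) ρ ≤ (∫ ρ)²` whenever `p x + q y ≤ |x - y|²/(2D²)`. With `p = -ε(g - a)` and `q =
ε(g - a) - D²ε²|∇g|²`, second order expansion in `ε` bounds the weighted variance of `g` by `4D²`
times its weighted Dirichlet energy; removing the weight costs a factor `e`.

For a weakly differentiable function, mollify, use the smooth inequality on the convex set of points
at a given depth inside `Ω`, and let the depth tend to zero. -/

/-! ### Brunn–Minkowski and Prékopa–Leindler inequalities for midpoints -/

open scoped Pointwise in
/-- The one-dimensional Brunn–Minkowski inequality for midpoints. -/
theorem Real.volume_add_volume_le_of_midpoint_mem {A B S : Set ℝ} (hA : MeasurableSet A)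
    (hB : MeasurableSet B) (hA0 : A.Nonempty) (hB0 : B.Nonempty)
    (h : ∀ x ∈ A, ∀ y ∈ B, (2 : ℝ)⁻¹ • (x + y) ∈ S) :
    volume A + volume B ≤ 2 * volume S := by
  have compact_case : ∀ K ⊆ A, ∀ L ⊆ B, IsCompact K → IsCompact L → K.Nonempty → L.Nonempty →
      volume K + volume L ≤ 2 * volume S := by
    intro K hKA L hLB hK hL hK0 hL0
    obtain ⟨a, ha, ha'⟩ := hK.exists_isGreatest hK0
    obtain ⟨b, hb, hb'⟩ := hL.exists_isLeast hL0
    have e1 : volume ((fun x : ℝ => x + b) '' K) = volume K := by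
      rw [Set.image_add_right, measure_preimage_add_right]
    have e2 : volume ((fun x : ℝ => a + x) '' L) = volume L := by
      rw [Set.image_add_left, measure_preimage_add]
    -- With `a = max K` and `b = min L`, the translates `K + b` and `a + L` lie on opposite sides of
    -- `a + b`, and both lie in `2S`.
    have hdisj : AEDisjoint volume ((fun x : ℝ => x + b) '' K) ((fun x : ℝ => a + x) '' L) := by
      refine measure_mono_null (t := {a + b}) ?_ (by simp)
      rintro _ ⟨⟨x, hx, rfl⟩, ⟨y, hy, hxy⟩⟩
      have h1 := ha' hx
      have h2 := hb' hy
      simp only [Set.mem_singleton_iff] at hxy ⊢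
      linarith
    have hm : MeasurableSet ((fun x : ℝ => a + x) '' L) :=
      (hL.image (by fun_prop)).measurableSet
    have e3 := measure_union₀ hm.nullMeasurableSet hdisj
    rw [e1, e2] at e3
    rw [← e3]
    calc _ ≤ volume ((fun x : ℝ => (2 : ℝ) • x) '' S) := by
          refine measure_mono ?_
          rintro _ (⟨x, hx, rfl⟩ | ⟨x, hx, rfl⟩)
          · exact ⟨_, h x (hKA hx) b (hLB hb), by simp [smul_eq_mul]⟩
          · exact ⟨_, h a (hKA ha) x (hLB hx), by simp [smul_eq_mul]⟩
      _ = 2 * volume S := by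
          rw [Set.image_smul, Measure.addHaar_smul]; simp
  obtain ⟨a, ha⟩ := hA0
  obtain ⟨b, hb⟩ := hB0
  have sup : ∀ T : Set ℝ, MeasurableSet T →
      volume T = ⨆ K, ⨆ _ : K ⊆ T ∧ IsCompact K, volume K := by
    intro T hT
    rw [hT.measure_eq_iSup_isCompact]
    simp only [iSup_and]
  rw [sup A hA, sup B hB]
  refine ENNReal.biSup_add_biSup_le' ⟨∅, by simp⟩ ⟨∅, by simp⟩ fun K ⟨hKA, hK⟩ L ⟨hLB, hL⟩ => ?_
  -- An approximating compact set may be empty; inserting a point of `A` or `B` makes it nonempty.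
  calc volume K + volume L ≤ volume (insert a K) + volume (insert b L) :=
        add_le_add (measure_mono (Set.subset_insert _ _)) (measure_mono (Set.subset_insert _ _))
    _ ≤ _ := compact_case _ (Set.insert_subset ha hKA) _ (Set.insert_subset hb hLB) (hK.insert a)
        (hL.insert b) (Set.insert_nonempty _ _) (Set.insert_nonempty _ _)

/-- The one-dimensional Prékopa–Leindler inequality in additive form, for functions of
supremum one. -/
theorem Real.lintegral_add_lintegral_le_of_midpoint {f g h : ℝ → ℝ} (hf : Measurable f)
    (hg : Measurable g) (hh : Measurable h) (hf0 : ∀ x, 0 ≤ f x) (hg0 : ∀ x, 0 ≤ g x)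
    (hh0 : ∀ x, 0 ≤ h x) (hf1 : ∀ x, f x ≤ 1) (hg1 : ∀ x, g x ≤ 1)
    (hfs : ∀ t < 1, ∃ x, t < f x) (hgs : ∀ t < 1, ∃ x, t < g x)
    (H : ∀ x y, f x * g y ≤ h ((2 : ℝ)⁻¹ • (x + y)) ^ 2) :
    (∫⁻ x, ENNReal.ofReal (f x)) + ∫⁻ x, ENNReal.ofReal (g x) ≤
      2 * ∫⁻ x, ENNReal.ofReal (h x) := by
  rw [lintegral_eq_lintegral_meas_lt _ (Filter.Eventually.of_forall hf0) hf.aemeasurable,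
    lintegral_eq_lintegral_meas_lt _ (Filter.Eventually.of_forall hg0) hg.aemeasurable,
    lintegral_eq_lintegral_meas_lt _ (Filter.Eventually.of_forall hh0) hh.aemeasurable]
  have hanti : Antitone fun t : ℝ => volume {a | t < f a} := fun s t hst =>
    measure_mono fun x hx => lt_of_le_of_lt hst hx
  rw [← lintegral_add_left hanti.measurable, ← lintegral_const_mul' _ _ (by simp)]
  refine setLIntegral_mono' measurableSet_Ioi fun t ht => ?_
  rw [Set.mem_Ioi] at ht
  -- After the layer-cake formula, superlevel sets are compared at each height. Below height one
  -- both are nonempty, as Brunn–Minkowski requires; from height one on, those of `f` and `g` are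
  -- empty.
  rcases lt_or_ge t 1 with h1 | h1
  · refine Real.volume_add_volume_le_of_midpoint_mem (measurableSet_lt measurable_const hf)
      (measurableSet_lt measurable_const hg) (hfs t h1) (hgs t h1) fun x hx y hy => ?_
    simp only [Set.mem_ofPred_eq] at hx hy ⊢
    refine lt_of_pow_lt_pow_left₀ 2 (hh0 _) (lt_of_lt_of_le ?_ (H x y))
    nlinarith
  · have e1 : {a | t < f a} = ∅ := by
      ext x; simpa using (hf1 x).trans h1
    have e2 : {a | t < g a} = ∅ := by
      ext x; simpa using (hg1 x).trans h1
    simp [e1, e2]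

/-- The midpoint Prékopa–Leindler property of a measure. -/
def MidpointPrekopaLeindler {E : Type*} [AddCommGroup E] [Module ℝ E] [MeasurableSpace E]
    (μ : Measure E) : Prop :=
  ∀ f g h : E → ENNReal, Measurable f → Measurable g → Measurable h →
    (∀ x y, f x * g y ≤ h ((2 : ℝ)⁻¹ • (x + y)) ^ 2) →
    (∫⁻ x, f x ∂μ) * ∫⁻ x, g x ∂μ ≤ (∫⁻ x, h x ∂μ) ^ 2

theorem ENNReal.mul_le_of_add_le {a b c : ENNReal} (h : a + b ≤ 2 * c) : a * b ≤ c ^ 2 := by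
  rcases eq_or_ne c ⊤ with rfl | hc
  · simp
  have hab : a + b ≠ ⊤ := ne_top_of_le_ne_top (by finiteness) h
  lift c to NNReal using hc
  lift a to NNReal using (fun h => hab (by simp [h]))
  lift b to NNReal using (fun h => hab (by simp [h]))
  norm_cast at h ⊢
  rw [← NNReal.coe_le_coe] at h ⊢
  push_cast at h ⊢
  nlinarith [sq_nonneg ((a : ℝ) - b), a.2, b.2, c.2]

/-- Dividing `f` and `g` by their suprema `a`, `b` and `h` by `√(a * b)` preserves the hypothesis
and reduces to the additive form; AM–GM then gives the product form, in which the normalisations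
cancel. -/
theorem Real.lintegral_mul_lintegral_le_of_midpoint {f g h : ℝ → ℝ} (hf : Measurable f)
    (hg : Measurable g) (hh : Measurable h) (hf0 : ∀ x, 0 ≤ f x) (hg0 : ∀ x, 0 ≤ g x)
    (hh0 : ∀ x, 0 ≤ h x) (hfb : BddAbove (Set.range f)) (hgb : BddAbove (Set.range g))
    (H : ∀ x y, f x * g y ≤ h ((2 : ℝ)⁻¹ • (x + y)) ^ 2) :
    (∫⁻ x, ENNReal.ofReal (f x)) * ∫⁻ x, ENNReal.ofReal (g x) ≤
      (∫⁻ x, ENNReal.ofReal (h x)) ^ 2 := by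
  obtain ⟨a, ha⟩ : ∃ a, (⨆ x, f x) = a := ⟨_, rfl⟩
  obtain ⟨b, hb⟩ : ∃ b, (⨆ x, g x) = b := ⟨_, rfl⟩
  have hfa : ∀ x, f x ≤ a := fun x => ha ▸ le_ciSup hfb x
  have hgb' : ∀ x, g x ≤ b := fun x => hb ▸ le_ciSup hgb x
  rcases ((hf0 0).trans (hfa 0)).eq_or_lt with rfl | hpa
  · have : ∀ x, f x = 0 := fun x => le_antisymm (hfa x) (hf0 x)
    simp [this]
  rcases ((hg0 0).trans (hgb' 0)).eq_or_lt with rfl | hpb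
  · have : ∀ x, g x = 0 := fun x => le_antisymm (hgb' x) (hg0 x)
    simp [this]
  have hab : 0 < a * b := mul_pos hpa hpb
  obtain ⟨c, hc⟩ : ∃ c, c = √(a * b) := ⟨_, rfl⟩
  have hpc : 0 < c := hc ▸ Real.sqrt_pos.2 hab
  have hcR : c ^ 2 = a * b := by rw [hc, Real.sq_sqrt hab.le]
  have key := Real.lintegral_add_lintegral_le_of_midpoint
    (f := fun x => a⁻¹ * f x) (g := fun x => b⁻¹ * g x) (h := fun x => c⁻¹ * h x)
    (by fun_prop) (by fun_prop) (by fun_prop)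
    (fun x => mul_nonneg (by positivity) (hf0 x)) (fun x => mul_nonneg (by positivity) (hg0 x))
    (fun x => mul_nonneg (by positivity) (hh0 x))
    (fun x => by rw [inv_mul_le_one₀ hpa]; exact hfa x)
    (fun x => by rw [inv_mul_le_one₀ hpb]; exact hgb' x)
    (fun t ht => by
      obtain ⟨x, hx⟩ := exists_lt_of_lt_ciSup (f := f) (b := a * t) (by rw [ha]; nlinarith)
      exact ⟨x, by rwa [lt_inv_mul_iff₀ hpa]⟩)
    (fun t ht => by
      obtain ⟨x, hx⟩ := exists_lt_of_lt_ciSup (f := g) (b := b * t) (by rw [hb]; nlinarith)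
      exact ⟨x, by rwa [lt_inv_mul_iff₀ hpb]⟩)
    (fun x y => by
      have := H x y
      rw [mul_pow, inv_pow, hcR, mul_mul_mul_comm, ← mul_inv]
      gcongr)
  have pull : ∀ (r : ℝ) (k : ℝ → ℝ), 0 < r → (∫⁻ x, ENNReal.ofReal (r⁻¹ * k x)) =
      (ENNReal.ofReal r)⁻¹ * ∫⁻ x, ENNReal.ofReal (k x) := by
    intro r k hr
    rw [← lintegral_const_mul' _ _ (by simpa using hr)]
    refine lintegral_congr fun x => ?_
    rw [ENNReal.ofReal_mul (by positivity), ENNReal.ofReal_inv_of_pos hr]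
  rw [pull a f hpa, pull b g hpb, pull c h hpc] at key
  have key2 := ENNReal.mul_le_of_add_le key
  have hcE : ENNReal.ofReal c ^ 2 = ENNReal.ofReal a * ENNReal.ofReal b := by
    rw [← ENNReal.ofReal_pow hpc.le, hcR, ENNReal.ofReal_mul hpa.le]
  rw [mul_pow, mul_mul_mul_comm, ← ENNReal.inv_pow, hcE, ← ENNReal.mul_inv (by simp) (by simp),
    ← hcE] at key2
  exact (ENNReal.mul_le_mul_iff_right (by simp) (by simpa using hpc)).1 key2

theorem ENNReal.iSup_min_natCast (x : ENNReal) : ⨆ n : ℕ, min x n = x := by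
  have := inf_iSup_eq x (fun n : ℕ => (n : ENNReal))
  rw [ENNReal.iSup_natCast, inf_top_eq] at this
  exact this.symm

/-- Truncating all three functions at the same height `n` preserves the hypothesis; monotone
convergence removes the truncation. -/
theorem midpointPrekopaLeindler_real : MidpointPrekopaLeindler (volume : Measure ℝ) := by
  intro f g h hf hg hh H
  have ofR : ∀ (n : ℕ) (x : ENNReal), ENNReal.ofReal (min x n).toReal = min x n := fun n x =>
    ENNReal.ofReal_toReal (ne_top_of_le_ne_top (by simp) (min_le_right _ _))
  have bd : ∀ (n : ℕ) (k : ℝ → ENNReal), BddAbove (Set.range fun x => (min (k x) n).toReal) := by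
    rintro n k
    refine ⟨n, ?_⟩
    rintro _ ⟨x, rfl⟩
    exact ENNReal.toReal_le_coe_of_le_coe (b := n) (by simp)
  have step : ∀ n : ℕ, (∫⁻ x, min (f x) n) * ∫⁻ x, min (g x) n ≤ (∫⁻ x, h x) ^ 2 := by
    intro n
    have := Real.lintegral_mul_lintegral_le_of_midpoint
      (f := fun x => (min (f x) n).toReal) (g := fun x => (min (g x) n).toReal)
      (h := fun x => (min (h x) n).toReal) (by fun_prop) (by fun_prop) (by fun_prop)
      (fun x => ENNReal.toReal_nonneg) (fun x => ENNReal.toReal_nonneg)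
      (fun x => ENNReal.toReal_nonneg) (bd n f) (bd n g)
      (fun x y => by
        rw [← ENNReal.toReal_mul, ← ENNReal.toReal_pow]
        refine ENNReal.toReal_mono ?_ ?_
        · exact ENNReal.pow_ne_top (ne_top_of_le_ne_top (by simp) (min_le_right _ _))
        · rcases le_total (h ((2 : ℝ)⁻¹ • (x + y))) n with h1 | h1
          · rw [min_eq_left h1]
            exact (mul_le_mul' (min_le_left _ _) (min_le_left _ _)).trans (H x y)
          · rw [min_eq_right h1, sq]
            exact mul_le_mul' (min_le_right _ _) (min_le_right _ _))
    simp only [ofR] at this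
    refine this.trans ?_
    gcongr
    exact min_le_left _ _
  have mono : ∀ k : ℝ → ENNReal, Monotone fun (n : ℕ) x => min (k x) n := by
    intro k m n hmn x
    exact min_le_min_left _ (by exact_mod_cast hmn)
  have sup : ∀ k : ℝ → ENNReal, Measurable k → (∫⁻ x, k x) = ⨆ n : ℕ, ∫⁻ x, min (k x) n := by
    intro k hk
    rw [← lintegral_iSup (fun n => by fun_prop) (mono k)]
    simp only [ENNReal.iSup_min_natCast]
  rw [sup f hf, sup g hg]
  simp_rw [ENNReal.iSup_mul, ENNReal.mul_iSup]
  refine iSup₂_le fun m n => ?_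
  refine le_trans (mul_le_mul' (lintegral_mono (mono f (le_max_left m n)))
    (lintegral_mono (mono g (le_max_right m n)))) (step (max m n))

/-- By Tonelli: the inequality on the fibres over `x`, `y` and their midpoint is exactly the
hypothesis for the fibre integrals on the base. -/
theorem MidpointPrekopaLeindler.prod {E F : Type*} [AddCommGroup E] [Module ℝ E]
    [MeasurableSpace E] [AddCommGroup F] [Module ℝ F] [MeasurableSpace F] {μ : Measure E}
    {ν : Measure F} [SFinite ν] (hμ : MidpointPrekopaLeindler μ) (hν : MidpointPrekopaLeindler ν) :
    MidpointPrekopaLeindler (μ.prod ν) := by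
  intro f g h hf hg hh H
  rw [lintegral_prod _ hf.aemeasurable, lintegral_prod _ hg.aemeasurable,
    lintegral_prod _ hh.aemeasurable]
  exact hμ _ _ _ hf.lintegral_prod_right' hg.lintegral_prod_right' hh.lintegral_prod_right'
    fun x y => hν _ _ _ (by fun_prop) (by fun_prop) (by fun_prop) fun z w => H (x, z) (y, w)

theorem MidpointPrekopaLeindler.of_measurePreserving {E F : Type*} [AddCommGroup E] [Module ℝ E]
    [MeasurableSpace E] [AddCommGroup F] [Module ℝ F] [MeasurableSpace F] {μ : Measure E}
    {ν : Measure F} (hμ : MidpointPrekopaLeindler μ) (e : E →ₗ[ℝ] F)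
    (he : MeasurePreserving e μ ν) : MidpointPrekopaLeindler ν := by
  intro f g h hf hg hh H
  rw [← he.lintegral_comp hf, ← he.lintegral_comp hg, ← he.lintegral_comp hh]
  exact hμ _ _ _ (hf.comp he.measurable) (hg.comp he.measurable) (hh.comp he.measurable)
    fun x y => by simpa using H (e x) (e y)

theorem midpointPrekopaLeindler_pi (d : ℕ) :
    MidpointPrekopaLeindler (volume : Measure (Fin d → ℝ)) := by
  induction d with
  | zero =>
    intro f g h _ _ _ H
    simp only [lintegral_unique, volume_pi, Measure.pi_empty_univ, mul_one]
    convert H default default using 3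
  | succ d ih =>
    refine (midpointPrekopaLeindler_real.prod ih).of_measurePreserving
      (Fin.consLinearEquiv ℝ (fun _ : Fin (d + 1) => ℝ)).toLinearMap ?_
    have h : ⇑(Fin.consLinearEquiv ℝ (fun _ : Fin (d + 1) => ℝ)).toLinearMap =
        (MeasurableEquiv.piFinSuccAbove (fun _ : Fin (d + 1) => ℝ) 0).symm := by
      ext ⟨a, v⟩ j
      refine Fin.cases ?_ (fun k => ?_) j <;> simp [MeasurableEquiv.piFinSuccAbove]
    rw [h]
    exact (volume_preserving_piFinSuccAbove (fun _ : Fin (d + 1) => ℝ) 0).symm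

theorem midpointPrekopaLeindler_euclideanSpace (d : ℕ) :
    MidpointPrekopaLeindler (volume : Measure (EuclideanSpace ℝ (Fin d))) :=
  (midpointPrekopaLeindler_pi d).of_measurePreserving
    (WithLp.linearEquiv 2 ℝ (Fin d → ℝ)).symm.toLinearMap (PiLp.volume_preserving_toLp (Fin d))

/-! ### Poincaré inequality for smooth functions on convex sets -/

/-- For `t ≤ 0` this is the square of `1 + t/2 ≤ exp (t/2)`, whence the coefficient `1/4`. -/
theorem Real.one_add_add_sq_div_four_le_exp {t : ℝ} (ht : -1 ≤ t) :
    1 + t + t ^ 2 / 4 ≤ Real.exp t := by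
  rcases le_total 0 t with h | h
  · have := Real.quadratic_le_exp_of_nonneg h
    nlinarith [sq_nonneg t]
  · have h1 := Real.add_one_le_exp (t / 2)
    have h2 : Real.exp t = Real.exp (t / 2) ^ 2 := by
      rw [← Real.exp_nat_mul]; congr 1; push_cast; ring
    rw [h2]
    have h3 : 0 ≤ t / 2 + 1 := by linarith
    nlinarith

/-- The squared Euclidean norm of the gradient. -/
noncomputable def gradSq {d : ℕ} (g : EuclideanSpace ℝ (Fin d) → ℝ) (x : EuclideanSpace ℝ (Fin d)) : ℝ :=
  ∑ i, fderiv ℝ g x (EuclideanSpace.single i (1 : ℝ)) ^ 2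

theorem gradSq_nonneg {d : ℕ} (g : EuclideanSpace ℝ (Fin d) → ℝ) (x : EuclideanSpace ℝ (Fin d)) :
    0 ≤ gradSq g x := Finset.sum_nonneg fun _ _ => sq_nonneg _

theorem continuous_gradSq {d : ℕ} {g : EuclideanSpace ℝ (Fin d) → ℝ} (hg : ContDiff ℝ ∞ g) :
    Continuous (gradSq g) := by
  have : Continuous (fderiv ℝ g) := hg.continuous_fderiv (by simp)
  unfold gradSq
  fun_prop

theorem sq_fderiv_apply_le_gradSq_mul {d : ℕ} (g : EuclideanSpace ℝ (Fin d) → ℝ)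
    (x w : EuclideanSpace ℝ (Fin d)) : (fderiv ℝ g x w) ^ 2 ≤ gradSq g x * ‖w‖ ^ 2 := by
  have hw : w = ∑ i, w i • EuclideanSpace.single i (1 : ℝ) := by
    ext j
    simp [Pi.single_apply]
  have h1 : fderiv ℝ g x w = ∑ i, fderiv ℝ g x (EuclideanSpace.single i (1 : ℝ)) * w i := by
    conv_lhs => rw [hw]
    simp [mul_comm]
  rw [h1, EuclideanSpace.real_norm_sq_eq]
  exact Finset.sum_mul_sq_le_sq_mul_sq _ _ _

/-- First order Taylor expansion of a test function with uniform quadratic remainder. -/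
theorem exists_sub_le_fderiv_add_mul_sq {E : Type*} [NormedAddCommGroup E] [NormedSpace ℝ E]
    {g : E → ℝ} (hg : ContDiff ℝ ∞ g) (hgc : HasCompactSupport g) :
    ∃ L : ℝ, 0 ≤ L ∧ ∀ x y, g y - g x ≤ fderiv ℝ g y (y - x) + L * ‖x - y‖ ^ 2 := by
  obtain ⟨L, hL⟩ : ∃ L, LipschitzWith L (fderiv ℝ g) :=
    (hg.fderiv_right (m := 1) (by norm_cast)).lipschitzWith_of_hasCompactSupport
      (hgc.fderiv (𝕜 := ℝ)) (by simp)
  refine ⟨L, L.2, fun x y => ?_⟩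
  have hd : Differentiable ℝ g := hg.differentiable (by simp)
  have := (convex_closedBall y ‖x - y‖).norm_image_sub_le_of_norm_fderiv_le' (𝕜 := ℝ)
    (f := g) (φ := fderiv ℝ g y) (C := L * ‖x - y‖) (x := y) (y := x) (fun z _ => hd z)
    (fun z hz => by
      refine (hL.norm_sub_le z y).trans ?_
      gcongr
      simpa [dist_eq_norm] using hz)
    (by simp) (by simp [dist_eq_norm])
  rw [Real.norm_eq_abs] at this
  have h2 := (abs_le.1 this).1
  have h3 : fderiv ℝ g y (y - x) = - fderiv ℝ g y (x - y) := by rw [← map_neg, neg_sub]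
  rw [h3]
  nlinarith

/-- Maurey's form of the Prékopa–Leindler inequality for a Gaussian measure restricted to a
convex set. -/
theorem integral_exp_mul_integral_exp_le {d : ℕ} {A : Set (EuclideanSpace ℝ (Fin d))}
    (hA : Convex ℝ A) (hAm : MeasurableSet A) {x₀ : EuclideanSpace ℝ (Fin d)} {D s : ℝ}
    (hAD : A ⊆ Metric.closedBall x₀ D) {p q : EuclideanSpace ℝ (Fin d) → ℝ} (hp : Continuous p)
    (hq : Continuous q) (H : ∀ x y, p x + q y ≤ s / 2 * ‖x - y‖ ^ 2) :
    (∫ x in A, Real.exp (p x) * Real.exp (-(s * ‖x - x₀‖ ^ 2))) *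
      (∫ x in A, Real.exp (q x) * Real.exp (-(s * ‖x - x₀‖ ^ 2))) ≤
      (∫ x in A, Real.exp (-(s * ‖x - x₀‖ ^ 2))) ^ 2 := by
  have int : ∀ k : EuclideanSpace ℝ (Fin d) → ℝ, Continuous k → IntegrableOn k A := fun k hk =>
    (hk.continuousOn.integrableOn_compact (isCompact_closedBall x₀ D)).mono_set hAD
  have key := midpointPrekopaLeindler_euclideanSpace d
    (A.indicator fun x => ENNReal.ofReal (Real.exp (p x) * Real.exp (-(s * ‖x - x₀‖ ^ 2))))
    (A.indicator fun x => ENNReal.ofReal (Real.exp (q x) * Real.exp (-(s * ‖x - x₀‖ ^ 2))))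
    (A.indicator fun x => ENNReal.ofReal (Real.exp (-(s * ‖x - x₀‖ ^ 2))))
    (Measurable.indicator (by fun_prop) hAm) (Measurable.indicator (by fun_prop) hAm)
    (Measurable.indicator (by fun_prop) hAm)
    (fun x y => by
      by_cases hx : x ∈ A
      swap; · simp [hx]
      by_cases hy : y ∈ A
      swap; · simp [hy]
      have hxy : (2 : ℝ)⁻¹ • (x + y) ∈ A := by
        rw [smul_add]
        exact hA hx hy (by norm_num) (by norm_num) (by norm_num)
      rw [Set.indicator_of_mem hx, Set.indicator_of_mem hy, Set.indicator_of_mem hxy,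
        ← ENNReal.ofReal_mul (by positivity), ← ENNReal.ofReal_pow (by positivity)]
      refine ENNReal.ofReal_le_ofReal ?_
      rw [← Real.exp_add, ← Real.exp_add, ← Real.exp_add, ← Real.exp_nat_mul, Real.exp_le_exp]
      -- The product of the weights at `x` and `y` is the squared weight at the midpoint times `exp
      -- (-(s/2)‖x - y‖²)`; this factor absorbs `exp (p x + q y)`.
      have par := parallelogram_law_with_norm ℝ (x - x₀) (y - x₀)
      have e1 : ‖(2 : ℝ)⁻¹ • (x + y) - x₀‖ ^ 2 = ‖x - x₀ + (y - x₀)‖ ^ 2 / 4 := by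
        have : (2 : ℝ)⁻¹ • (x + y) - x₀ = (2 : ℝ)⁻¹ • (x - x₀ + (y - x₀)) := by
          module
        rw [this, norm_smul]
        norm_num
        ring
      have e2 : x - x₀ - (y - x₀) = x - y := by abel
      rw [e2] at par
      rw [e1]
      have := H x y
      push_cast
      linear_combination this + s / 2 * par)
  rw [lintegral_indicator hAm, lintegral_indicator hAm, lintegral_indicator hAm,
    ← ofReal_integral_eq_lintegral_ofReal (int _ (by fun_prop))
      (Filter.Eventually.of_forall fun x => by positivity),
    ← ofReal_integral_eq_lintegral_ofReal (int _ (by fun_prop))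
      (Filter.Eventually.of_forall fun x => by positivity),
    ← ofReal_integral_eq_lintegral_ofReal (int _ (by fun_prop))
      (Filter.Eventually.of_forall fun x => by positivity),
    ← ENNReal.ofReal_mul (integral_nonneg fun x => by positivity),
    ← ENNReal.ofReal_pow (integral_nonneg fun x => by positivity)] at key
  exact (ENNReal.ofReal_le_ofReal_iff (by positivity)).1 key

theorem exists_integral_sub_sq_le_integral_gradSq {d : ℕ} {A : Set (EuclideanSpace ℝ (Fin d))}
    (hA : Convex ℝ A) (hAm : MeasurableSet A) {x₀ : EuclideanSpace ℝ (Fin d)} {D : ℝ} (hD : 0 < D)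
    (hAD : A ⊆ Metric.closedBall x₀ D) {g : EuclideanSpace ℝ (Fin d) → ℝ} (hg : ContDiff ℝ ∞ g)
    (hgc : HasCompactSupport g) :
    ∃ a : ℝ, ∫ x in A, (g x - a) ^ 2 ≤ 4 * Real.exp 1 * D ^ 2 * ∫ x in A, gradSq g x := by
  have int : ∀ k : EuclideanSpace ℝ (Fin d) → ℝ, Continuous k → IntegrableOn k A := fun k hk =>
    (hk.continuousOn.integrableOn_compact (isCompact_closedBall x₀ D)).mono_set hAD
  rcases eq_or_ne (volume A) 0 with h0 | h0
  · exact ⟨0, by simp [Measure.restrict_eq_zero.2 h0]⟩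
  have hAt : volume A ≠ ⊤ :=
    ((Metric.isBounded_closedBall.subset hAD).measure_lt_top).ne
  obtain ⟨ρ, hρ⟩ : ∃ ρ : EuclideanSpace ℝ (Fin d) → ℝ,
    ρ = fun x => Real.exp (-((D ^ 2)⁻¹ * ‖x - x₀‖ ^ 2)) := ⟨_, rfl⟩
  have hρc : Continuous ρ := by rw [hρ]; fun_prop
  have hρ0 : ∀ x, 0 < ρ x := fun x => by rw [hρ]; positivity
  have hρ1 : ∀ x, ρ x ≤ 1 := fun x => by
    rw [hρ]
    exact Real.exp_le_one_iff.2 (by simp only [Left.neg_nonpos_iff]; positivity)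
  have hρe : ∀ x ∈ A, 1 ≤ Real.exp 1 * ρ x := fun x hx => by
    have h1 : ‖x - x₀‖ ≤ D := by simpa [dist_eq_norm] using hAD hx
    rw [hρ]
    simp only
    rw [← Real.exp_add, Real.one_le_exp_iff, ← sub_eq_add_neg, sub_nonneg,
      inv_mul_le_one₀ (by positivity)]
    gcongr
  obtain ⟨m, hm⟩ : ∃ m, m = ∫ x in A, ρ x := ⟨_, rfl⟩
  have hm0 : 0 < m := by
    rw [hm, setIntegral_pos_iff_support_of_nonneg_ae
      (Filter.Eventually.of_forall fun x => (hρ0 x).le) (int _ hρc)]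
    have : Function.support ρ = Set.univ := by
      ext x; simp [(hρ0 x).ne']
    rw [this, Set.univ_inter]
    exact pos_iff_ne_zero.2 h0
  have hgcont : Continuous g := hg.continuous
  -- The weighted mean makes the terms linear in `ε` vanish.
  obtain ⟨a, ha⟩ : ∃ a, a = (∫ x in A, g x * ρ x) / m := ⟨_, rfl⟩
  have hmean : ∫ x in A, (g x - a) * ρ x = 0 := by
    have : ∀ x, (g x - a) * ρ x = g x * ρ x - a * ρ x := fun x => by ring
    simp_rw [this]
    rw [integral_sub (int _ (by fun_prop)) (int _ (by fun_prop)), integral_const_mul, ← hm, ha]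
    field_simp
    ring
  have hN := continuous_gradSq hg
  obtain ⟨V, hV⟩ : ∃ V, V = ∫ x in A, (g x - a) ^ 2 * ρ x := ⟨_, rfl⟩
  obtain ⟨W, hW⟩ : ∃ W, W = ∫ x in A, gradSq g x * ρ x := ⟨_, rfl⟩
  have hV0 : 0 ≤ V := hV ▸ integral_nonneg fun x => mul_nonneg (sq_nonneg _) (hρ0 x).le
  have hW0 : 0 ≤ W := hW ▸ integral_nonneg fun x => mul_nonneg (gradSq_nonneg _ _) (hρ0 x).le
  obtain ⟨L, hL0, hL⟩ := exists_sub_le_fderiv_add_mul_sq hg hgc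
  obtain ⟨B, hB⟩ := hgc.exists_bound_of_continuous hgcont
  -- Since `|g - a| ≤ B + |a|`, the first smallness condition keeps the exponent above `-1`; the
  -- second lets half of `‖x - y‖²/(2D²)` absorb the Taylor remainder. The other half pays for the
  -- AM–GM bound on `ε∇g(y)·(y - x)`.
  have step : ∀ ε : ℝ, 0 < ε → ε * (B + |a|) ≤ 1 → ε * L ≤ (4 * D ^ 2)⁻¹ →
      V * m / 4 ≤ D ^ 2 * W * m + ε ^ 2 * (D ^ 2 * V * W / 4) := by
    intro ε hε h1 h2
    have key := integral_exp_mul_integral_exp_le hA hAm (s := (D ^ 2)⁻¹) hAD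
      (p := fun x => -(ε * (g x - a))) (q := fun x => ε * (g x - a) - D ^ 2 * ε ^ 2 * gradSq g x)
      (by fun_prop) (by fun_prop) (fun x y => by
        have t1 := hL x y
        have t2 := sq_fderiv_apply_le_gradSq_mul g y (y - x)
        rw [norm_sub_rev y x] at t2
        set P := fderiv ℝ g y (y - x)
        have t3 := gradSq_nonneg g y
        set N := gradSq g y
        set r := ‖x - y‖ ^ 2 with hr
        have hr0 : 0 ≤ r := sq_nonneg _
        have t4 : ε * P ≤ D ^ 2 * ε ^ 2 * N + (4 * D ^ 2)⁻¹ * r := by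
          have u1 : 0 ≤ D ^ 2 * ε ^ 2 * N + (4 * D ^ 2)⁻¹ * r := by positivity
          refine abs_le_of_sq_le_sq' ?_ u1 |>.2
          have u2 : 4 * (D ^ 2 * ε ^ 2 * N) * ((4 * D ^ 2)⁻¹ * r) = ε ^ 2 * (N * r) := by
            field_simp
          nlinarith [sq_nonneg (D ^ 2 * ε ^ 2 * N - (4 * D ^ 2)⁻¹ * r), sq_nonneg ε,
            mul_le_mul_of_nonneg_left t2 (sq_nonneg ε)]
        have t5 : ε * (L * r) ≤ (4 * D ^ 2)⁻¹ * r := by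
          rw [← mul_assoc]; gcongr
        have t6 : (D ^ 2)⁻¹ / 2 = (4 * D ^ 2)⁻¹ + (4 * D ^ 2)⁻¹ := by
          field_simp; norm_num
        rw [t6]
        nlinarith)
    have hexp' : ∀ x, Real.exp (-((D ^ 2)⁻¹ * ‖x - x₀‖ ^ 2)) = ρ x := fun x => by rw [hρ]
    simp only [hexp'] at key
    rw [← hm] at key
    have low1 : m + ε ^ 2 * V / 4 ≤ ∫ x in A, Real.exp (-(ε * (g x - a))) * ρ x := by
      calc m + ε ^ 2 * V / 4 =
            ∫ x in A, ρ x - ε * ((g x - a) * ρ x) + ε ^ 2 / 4 * ((g x - a) ^ 2 * ρ x) := by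
            rw [integral_add (int _ (by fun_prop)) (int _ (by fun_prop)),
              integral_sub (int _ (by fun_prop)) (int _ (by fun_prop)), integral_const_mul,
              integral_const_mul, hmean, ← hV, ← hm]
            ring
        _ ≤ _ := by
            refine integral_mono (int _ (by fun_prop)) (int _ (by fun_prop)) fun x => ?_
            have b1 : |g x - a| ≤ B + |a| := (abs_sub _ _).trans (by gcongr; exact hB x)
            have b2 : -1 ≤ -(ε * (g x - a)) := by
              have := le_abs_self (g x - a)
              nlinarith
            have := mul_le_mul_of_nonneg_right (Real.one_add_add_sq_div_four_le_exp b2) (hρ0 x).le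
            simp only
            linarith
    have low2 : m - D ^ 2 * ε ^ 2 * W ≤
        ∫ x in A, Real.exp (ε * (g x - a) - D ^ 2 * ε ^ 2 * gradSq g x) * ρ x := by
      calc m - D ^ 2 * ε ^ 2 * W =
            ∫ x in A, ρ x + ε * ((g x - a) * ρ x) - D ^ 2 * ε ^ 2 * (gradSq g x * ρ x) := by
            rw [integral_sub (int _ (by fun_prop)) (int _ (by fun_prop)),
              integral_add (int _ (by fun_prop)) (int _ (by fun_prop)), integral_const_mul,
              integral_const_mul, hmean, ← hW, ← hm]
            ring
        _ ≤ _ := by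
            refine integral_mono (int _ (by fun_prop)) (int _ (by fun_prop)) fun x => ?_
            have := mul_le_mul_of_nonneg_right
              (Real.add_one_le_exp (ε * (g x - a) - D ^ 2 * ε ^ 2 * gradSq g x)) (hρ0 x).le
            simp only
            linarith
    have fin : (m + ε ^ 2 * V / 4) * (m - D ^ 2 * ε ^ 2 * W) ≤ m ^ 2 := by
      -- The two lower bounds may be multiplied only if the second is nonnegative; otherwise the
      -- product is nonpositive.
      rcases le_total 0 (m - D ^ 2 * ε ^ 2 * W) with h | h
      · exact (mul_le_mul low1 low2 h (integral_nonneg fun x =>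
          mul_nonneg (Real.exp_pos _).le (hρ0 x).le)).trans key
      · exact (mul_nonpos_of_nonneg_of_nonpos (by positivity) h).trans (by positivity)
    have : ε ^ 2 * (V * m / 4) ≤ ε ^ 2 * (D ^ 2 * W * m + ε ^ 2 * (D ^ 2 * V * W / 4)) := by
      nlinarith
    exact le_of_mul_le_mul_left this (by positivity)
  have lim : V * m / 4 ≤ D ^ 2 * W * m := by
    have t : Filter.Tendsto (fun ε : ℝ => D ^ 2 * W * m + ε ^ 2 * (D ^ 2 * V * W / 4))
        (nhdsWithin 0 (Set.Ioi 0)) (nhds (D ^ 2 * W * m)) := by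
      have : Continuous fun ε : ℝ => D ^ 2 * W * m + ε ^ 2 * (D ^ 2 * V * W / 4) := by fun_prop
      simpa using (this.tendsto 0).mono_left nhdsWithin_le_nhds
    refine ge_of_tendsto t ?_
    have c1 : ∀ᶠ ε : ℝ in nhdsWithin 0 (Set.Ioi 0), ε * (B + |a|) < 1 := by
      have : Continuous fun ε : ℝ => ε * (B + |a|) := by fun_prop
      exact ((this.tendsto 0).mono_left nhdsWithin_le_nhds).eventually_lt_const (by simp)
    have c2 : ∀ᶠ ε : ℝ in nhdsWithin 0 (Set.Ioi 0), ε * L < (4 * D ^ 2)⁻¹ := by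
      have : Continuous fun ε : ℝ => ε * L := by fun_prop
      refine ((this.tendsto 0).mono_left nhdsWithin_le_nhds).eventually_lt_const ?_
      simp only [zero_mul]
      positivity
    filter_upwards [c1, c2, self_mem_nhdsWithin] with ε e1 e2 e3
    exact step ε e3 e1.le e2.le
  have hVW : V ≤ 4 * D ^ 2 * W := by nlinarith
  refine ⟨a, ?_⟩
  calc ∫ x in A, (g x - a) ^ 2 ≤ ∫ x in A, Real.exp 1 * ((g x - a) ^ 2 * ρ x) := by
        refine setIntegral_mono_on (int _ (by fun_prop)) (int _ (by fun_prop)) hAm fun x hx => ?_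
        nlinarith [hρe x hx, sq_nonneg (g x - a)]
    _ = Real.exp 1 * V := by rw [integral_const_mul, hV]
    _ ≤ Real.exp 1 * (4 * D ^ 2 * W) := by gcongr
    _ ≤ Real.exp 1 * (4 * D ^ 2 * ∫ x in A, gradSq g x) := by
        gcongr
        rw [hW]
        refine integral_mono (int _ (by fun_prop)) (int _ hN) fun x => ?_
        exact mul_le_of_le_one_right (gradSq_nonneg _ _) (hρ1 x)
    _ = _ := by ring

/-! ### Mollification inside a convex domain -/

open scoped Convolution

/-- Jensen's inequality for the probability density `φ.normed`, obtained from nonnegativity of the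
variance. -/
theorem ContDiffBump.sq_normed_convolution_le {d : ℕ}
    (φ : ContDiffBump (0 : EuclideanSpace ℝ (Fin d))) {g : EuclideanSpace ℝ (Fin d) → ℝ}
    (hg : Integrable g) (hg2 : Integrable fun x => g x ^ 2) (x : EuclideanSpace ℝ (Fin d)) :
    ((φ.normed volume ⋆[ContinuousLinearMap.lsmul ℝ ℝ, volume] g) x) ^ 2 ≤
      (φ.normed volume ⋆[ContinuousLinearMap.lsmul ℝ ℝ, volume] fun x => g x ^ 2) x := by
  have i1 : Integrable fun t => φ.normed volume t * g (x - t) := by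
    simpa [ConvolutionExistsAt] using φ.hasCompactSupport_normed.convolutionExists_left
      (ContinuousLinearMap.lsmul ℝ ℝ) φ.continuous_normed hg.locallyIntegrable x
  have i2 : Integrable fun t => φ.normed volume t * g (x - t) ^ 2 := by
    simpa [ConvolutionExistsAt] using φ.hasCompactSupport_normed.convolutionExists_left
      (ContinuousLinearMap.lsmul ℝ ℝ) φ.continuous_normed hg2.locallyIntegrable x
  have i3 : Integrable (φ.normed volume) :=
    φ.continuous_normed.integrable_of_hasCompactSupport φ.hasCompactSupport_normed
  simp only [convolution_def, ContinuousLinearMap.lsmul_apply, smul_eq_mul]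
  set c := ∫ t, φ.normed volume t * g (x - t) with hc
  have h0 : 0 ≤ ∫ t, φ.normed volume t * (g (x - t) - c) ^ 2 :=
    integral_nonneg fun t => mul_nonneg (φ.nonneg_normed t) (sq_nonneg _)
  have h1 : ∫ t, φ.normed volume t * (g (x - t) - c) ^ 2 =
      (∫ t, φ.normed volume t * g (x - t) ^ 2) - 2 * c * c + c ^ 2 * 1 := by
    have e : ∀ t, φ.normed volume t * (g (x - t) - c) ^ 2 =
        φ.normed volume t * g (x - t) ^ 2 - 2 * c * (φ.normed volume t * g (x - t)) +
          c ^ 2 * φ.normed volume t := fun t => by ring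
    have i4 : Integrable fun t =>
        φ.normed volume t * g (x - t) ^ 2 - 2 * c * (φ.normed volume t * g (x - t)) :=
      i2.sub (i1.const_mul _)
    simp_rw [e]
    rw [integral_add i4 (i3.const_mul _), integral_sub i2 (i1.const_mul _),
      integral_const_mul, integral_const_mul, ← hc, φ.integral_normed]
  nlinarith

theorem integrable_sq_indicator {d : ℕ} {Ω : Set (EuclideanSpace ℝ (Fin d))} (hΩ : MeasurableSet Ω)
    {g : EuclideanSpace ℝ (Fin d) → ℝ} (hg : MemLp g 2 (volume.restrict Ω)) :
    Integrable fun x => Ω.indicator g x ^ 2 := by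
  have : (fun x => Ω.indicator g x ^ 2) = Ω.indicator fun x => g x ^ 2 := by
    ext x
    by_cases hx : x ∈ Ω <;> simp [hx]
  rw [this]
  exact (IntegrableOn.integrable_indicator hg.integrable_sq hΩ)

theorem integral_sq_indicator {d : ℕ} {Ω : Set (EuclideanSpace ℝ (Fin d))} (hΩ : MeasurableSet Ω)
    (g : EuclideanSpace ℝ (Fin d) → ℝ) :
    ∫ x, Ω.indicator g x ^ 2 = ∫ x in Ω, g x ^ 2 := by
  rw [← integral_indicator hΩ]
  congr 1
  ext x
  by_cases hx : x ∈ Ω <;> simp [hx]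

/-- Mollification commutes with weak derivatives away from the boundary. -/
theorem HasWeakDeriv.fderiv_normed_convolution {d : ℕ} {Ω : Set (EuclideanSpace ℝ (Fin d))}
    (hΩ : IsOpen Ω) {u g : EuclideanSpace ℝ (Fin d) → ℝ} {i : Fin d}
    (h : HasWeakDeriv Ω (fun _ : Fin 1 => i) u g) (hu : IntegrableOn u Ω)
    (φ : ContDiffBump (0 : EuclideanSpace ℝ (Fin d))) {x : EuclideanSpace ℝ (Fin d)}
    (hx : Metric.closedBall x φ.rOut ⊆ Ω) :
    fderiv ℝ (φ.normed volume ⋆[ContinuousLinearMap.lsmul ℝ ℝ, volume] Ω.indicator u) x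
        (EuclideanSpace.single i (1 : ℝ)) =
      (φ.normed volume ⋆[ContinuousLinearMap.lsmul ℝ ℝ, volume] Ω.indicator g) x := by
  have hui : Integrable (Ω.indicator u) := hu.integrable_indicator hΩ.measurableSet
  have hφ1 : ContDiff ℝ ∞ (φ.normed volume) := φ.contDiff_normed
  have hφd : Continuous (fderiv ℝ (φ.normed volume)) := hφ1.continuous_fderiv (by simp)
  have e1 : fderiv ℝ (φ.normed volume ⋆[ContinuousLinearMap.lsmul ℝ ℝ, volume] Ω.indicator u) x
        (EuclideanSpace.single i (1 : ℝ)) =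
      ∫ t, Ω.indicator u t * fderiv ℝ (φ.normed volume) (x - t)
        (EuclideanSpace.single i (1 : ℝ)) := by
    have := φ.hasCompactSupport_normed.hasFDerivAt_convolution_right
      (ContinuousLinearMap.lsmul ℝ ℝ).flip hui.locallyIntegrable
      (φ.contDiff_normed (μ := volume) (n := 1)) x
    rw [convolution_flip] at this
    rw [this.fderiv, convolution_precompR_apply _ hui.locallyIntegrable
      (φ.hasCompactSupport_normed.fderiv ℝ) hφd, convolution_def]
    simp [mul_comm]
  have hψ : ContDiff ℝ ∞ fun t => φ.normed volume (x - t) := hφ1.comp (by fun_prop)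
  have hsupp : tsupport (fun t => φ.normed volume (x - t)) ⊆ Metric.closedBall x φ.rOut := by
    refine closure_minimal ?_ Metric.isClosed_closedBall
    intro t ht
    have : x - t ∈ Function.support (φ.normed volume) := ht
    rw [φ.support_normed_eq] at this
    rw [Metric.mem_closedBall, dist_comm, dist_eq_norm]
    simpa using (Metric.mem_ball.1 this).le
  -- The reflected kernel `t ↦ φ (x - t)` is an admissible test function because the closed ball
  -- lies in `Ω`; the sign from the reflection cancels that of the weak derivative.
  have key := h.2.2 _ hψ
    (HasCompactSupport.of_support_subset_isCompact (isCompact_closedBall x φ.rOut)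
      ((subset_tsupport _).trans hsupp)) (hsupp.trans hx)
  have e2 : ∀ t, fderiv ℝ (fun t => φ.normed volume (x - t)) t (EuclideanSpace.single i (1 : ℝ)) =
      -fderiv ℝ (φ.normed volume) (x - t) (EuclideanSpace.single i (1 : ℝ)) := by
    intro t
    have hd : DifferentiableAt ℝ (φ.normed volume) (x - t) :=
      (hφ1.differentiable (by simp)).differentiableAt
    have := hd.hasFDerivAt.comp t ((hasFDerivAt_id t).const_sub x)
    have e := this.fderiv
    simp only [Function.comp_def] at e
    rw [e]
    simp
  simp only [iteratedFDeriv_one_apply, e2, pow_one, mul_neg, integral_neg, neg_mul, one_mul,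
    neg_inj] at key
  rw [e1, convolution_eq_swap]
  simp only [ContinuousLinearMap.lsmul_apply, smul_eq_mul]
  rw [← integral_indicator hΩ.measurableSet, ← integral_indicator hΩ.measurableSet] at key
  refine (integral_congr_ae (.of_forall fun t => ?_)).trans
    (key.trans (integral_congr_ae (.of_forall fun t => ?_)))
  · by_cases ht : t ∈ Ω <;> simp [ht]
  · by_cases ht : t ∈ Ω <;> simp [ht, mul_comm]

/-- Shifting `x` and `y` by the same vector shifts their convex combination by it. Convexity of this
set is what lets the smooth Poincaré inequality be applied there. -/
theorem convex_setOf_closedBall_subset {E : Type*} [NormedAddCommGroup E] [NormedSpace ℝ E]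
    {Ω : Set E} (hΩ : Convex ℝ Ω) (r : ℝ) : Convex ℝ {x | Metric.closedBall x r ⊆ Ω} := by
  intro x hx y hy a b ha hb hab z hz
  have : z = a • (x + (z - (a • x + b • y))) + b • (y + (z - (a • x + b • y))) := by
    have : z - (a • x + b • y) = (a + b) • (z - (a • x + b • y)) := by rw [hab, one_smul]
    rw [smul_add, smul_add, add_add_add_comm, ← add_smul, ← this]
    abel
  rw [this]
  rw [Metric.mem_closedBall, dist_eq_norm] at hz
  refine hΩ (hx ?_) (hy ?_) ha hb hab <;> simpa [dist_eq_norm] using hz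

theorem isOpen_setOf_closedBall_subset {E : Type*} [NormedAddCommGroup E] [ProperSpace E]
    {Ω : Set E} (hΩ : IsOpen Ω) (r : ℝ) : IsOpen {x | Metric.closedBall x r ⊆ Ω} := by
  rw [Metric.isOpen_iff]
  intro x hx
  obtain ⟨δ, hδ, h⟩ := (isCompact_closedBall x r).exists_thickening_subset_open hΩ hx
  refine ⟨δ, hδ, fun y hy z hz => h ?_⟩
  rw [Metric.mem_thickening_iff]
  refine ⟨z + (x - y), ?_, ?_⟩
  · rw [Metric.mem_closedBall, dist_eq_norm] at hz ⊢
    convert hz using 2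
    abel
  · rw [Metric.mem_ball, dist_eq_norm] at hy
    rw [dist_eq_norm]
    convert hy using 2
    abel

/-- The Poincaré inequality for mollifications, on the part of a convex domain where they commute
with weak derivatives. -/
theorem exists_integral_normed_convolution_sub_sq_le {d : ℕ}
    {Ω : Set (EuclideanSpace ℝ (Fin d))} (hΩ : IsOpen Ω) (hc : Convex ℝ Ω)
    {x₀ : EuclideanSpace ℝ (Fin d)} {D : ℝ} (hD : 0 < D) (hΩD : Ω ⊆ Metric.closedBall x₀ D)
    {u : EuclideanSpace ℝ (Fin d) → ℝ} {g : Fin d → EuclideanSpace ℝ (Fin d) → ℝ}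
    (hu : IntegrableOn u Ω) (hg : ∀ i, MemLp (g i) 2 (volume.restrict Ω))
    (h : ∀ i, HasWeakDeriv Ω (fun _ : Fin 1 => i) u (g i))
    (φ : ContDiffBump (0 : EuclideanSpace ℝ (Fin d))) :
    ∃ a : ℝ, ∫ x in {x | Metric.closedBall x φ.rOut ⊆ Ω},
        ((φ.normed volume ⋆[ContinuousLinearMap.lsmul ℝ ℝ, volume] Ω.indicator u) x - a) ^ 2 ≤
      4 * Real.exp 1 * D ^ 2 * ∑ i, ∫ x in Ω, g i x ^ 2 := by
  have hui : Integrable (Ω.indicator u) := hu.integrable_indicator hΩ.measurableSet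
  have hfin : IsFiniteMeasure (volume.restrict Ω) :=
    ⟨by simpa using (Metric.isBounded_closedBall.subset hΩD).measure_lt_top⟩
  have hgi : ∀ i, Integrable (Ω.indicator (g i)) := fun i =>
    IntegrableOn.integrable_indicator ((hg i).integrable (by norm_num)) hΩ.measurableSet
  have hg2 := fun i => integrable_sq_indicator hΩ.measurableSet (hg i)
  set U := φ.normed volume ⋆[ContinuousLinearMap.lsmul ℝ ℝ, volume] Ω.indicator u with hU
  have hUs : ContDiff ℝ ∞ U := φ.hasCompactSupport_normed.contDiff_convolution_left _
    φ.contDiff_normed hui.locallyIntegrable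
  have hUc : HasCompactSupport U := φ.hasCompactSupport_normed.convolution _
    (HasCompactSupport.of_support_subset_isCompact (isCompact_closedBall x₀ D)
      (Set.support_indicator_subset.trans hΩD))
  have hAm := (isOpen_setOf_closedBall_subset hΩ φ.rOut).measurableSet
  have hAΩ : {x | Metric.closedBall x φ.rOut ⊆ Ω} ⊆ Ω := fun x hx =>
    hx (Metric.mem_closedBall_self φ.rOut_pos.le)
  obtain ⟨a, ha⟩ := exists_integral_sub_sq_le_integral_gradSq
    (convex_setOf_closedBall_subset hc φ.rOut) hAm hD (hAΩ.trans hΩD) hUs hUc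
  refine ⟨a, ha.trans ?_⟩
  gcongr
  have hci : ∀ i, Integrable (φ.normed volume ⋆[ContinuousLinearMap.lsmul ℝ ℝ, volume]
      fun x => Ω.indicator (g i) x ^ 2) := fun i =>
    (φ.continuous_normed.integrable_of_hasCompactSupport
      φ.hasCompactSupport_normed).integrable_convolution _ (hg2 i)
  calc ∫ x in {x | Metric.closedBall x φ.rOut ⊆ Ω}, gradSq U x ≤
        ∫ x in {x | Metric.closedBall x φ.rOut ⊆ Ω}, ∑ i,
          (φ.normed volume ⋆[ContinuousLinearMap.lsmul ℝ ℝ, volume]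
            fun x => Ω.indicator (g i) x ^ 2) x := by
        refine setIntegral_mono_on ?_ (integrable_finsetSum _ fun i _ => (hci i).integrableOn)
          hAm fun x hx => ?_
        · exact ((continuous_gradSq hUs).continuousOn.integrableOn_compact
            (isCompact_closedBall x₀ D)).mono_set (hAΩ.trans hΩD)
        · refine Finset.sum_le_sum fun i _ => ?_
          rw [hU, (h i).fderiv_normed_convolution hΩ hu φ hx]
          exact φ.sq_normed_convolution_le (hgi i) (hg2 i) x
    _ = ∑ i, ∫ x in {x | Metric.closedBall x φ.rOut ⊆ Ω},
          (φ.normed volume ⋆[ContinuousLinearMap.lsmul ℝ ℝ, volume]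
            fun x => Ω.indicator (g i) x ^ 2) x :=
        integral_finsetSum _ fun i _ => (hci i).integrableOn
    _ ≤ ∑ i, ∫ x in Ω, g i x ^ 2 := by
        refine Finset.sum_le_sum fun i _ => ?_
        refine (setIntegral_le_integral (hci i) (Filter.Eventually.of_forall fun x => ?_)).trans ?_
        · exact integral_nonneg fun t => mul_nonneg (φ.nonneg_normed _) (sq_nonneg _)
        · rw [integral_convolution _ (φ.continuous_normed.integrable_of_hasCompactSupport
            φ.hasCompactSupport_normed) (hg2 i), φ.integral_normed,
            integral_sq_indicator hΩ.measurableSet]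
          simp

/-! ### Passage to the limit and the Poincaré inequality for weak derivatives -/

/-- Doubling the variable removes the constant `a`, which changes with the mollification and would
otherwise need a limit of its own. -/
theorem lintegral_lintegral_sub_sq_le {α : Type*} [MeasurableSpace α] {μ : Measure α}
    {f : α → ℝ} (hf : Measurable f) (a : ℝ) {M : ENNReal}
    (h : ∫⁻ x, ENNReal.ofReal ((f x - a) ^ 2) ∂μ ≤ M) :
    ∫⁻ x, ∫⁻ y, ENNReal.ofReal ((f x - f y) ^ 2) ∂μ ∂μ ≤ 4 * M * μ Set.univ := by
  have pt : ∀ x y, ENNReal.ofReal ((f x - f y) ^ 2) ≤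
      2 * ENNReal.ofReal ((f x - a) ^ 2) + 2 * ENNReal.ofReal ((f y - a) ^ 2) := by
    intro x y
    rw [← ENNReal.ofReal_ofNat 2, ← ENNReal.ofReal_mul (by norm_num),
      ← ENNReal.ofReal_mul (by norm_num), ← ENNReal.ofReal_add (by positivity) (by positivity)]
    refine ENNReal.ofReal_le_ofReal ?_
    nlinarith [sq_nonneg (f x - a + (f y - a))]
  calc ∫⁻ x, ∫⁻ y, ENNReal.ofReal ((f x - f y) ^ 2) ∂μ ∂μ
      ≤ ∫⁻ x, (2 * ENNReal.ofReal ((f x - a) ^ 2) * μ Set.univ + 2 * M) ∂μ := by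
        refine lintegral_mono fun x => ?_
        refine (lintegral_mono (pt x)).trans ?_
        rw [lintegral_add_left measurable_const, lintegral_const, lintegral_const_mul _ (by fun_prop)]
        gcongr
    _ ≤ 2 * M * μ Set.univ + 2 * M * μ Set.univ := by
        rw [lintegral_add_right _ measurable_const, lintegral_const,
          lintegral_mul_const _ (by fun_prop), lintegral_const_mul _ (by fun_prop)]
        gcongr
    _ = _ := by ring

/-- Fatou's lemma for double integrals of squared differences over an exhaustion. -/
theorem lintegral_lintegral_sub_sq_le_of_tendsto {α : Type*} [MeasurableSpace α] {μ : Measure α}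
    [SFinite μ] {A : ℕ → Set α} (hA : ∀ n, MeasurableSet (A n)) {U : ℕ → α → ℝ}
    (hU : ∀ n, Measurable (U n)) {u : α → ℝ}
    (hlim : ∀ᵐ x ∂μ, Filter.Tendsto (fun n => U n x) Filter.atTop (nhds (u x)))
    (hev : ∀ᵐ x ∂μ, ∀ᶠ n in Filter.atTop, x ∈ A n) {M : ENNReal}
    (hM : ∀ n, ∫⁻ x in A n, ∫⁻ y in A n, ENNReal.ofReal ((U n x - U n y) ^ 2) ∂μ ∂μ ≤ M) :
    AEMeasurable (fun x => ∫⁻ y, ENNReal.ofReal ((u x - u y) ^ 2) ∂μ) μ ∧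
      ∫⁻ x, ∫⁻ y, ENNReal.ofReal ((u x - u y) ^ 2) ∂μ ∂μ ≤ M := by
  obtain ⟨k, hk⟩ : ∃ k : ℕ → α × α → ENNReal, k = fun n => (A n ×ˢ A n).indicator fun p =>
    ENNReal.ofReal ((U n p.1 - U n p.2) ^ 2) := ⟨_, rfl⟩
  have hkm : ∀ n, Measurable (k n) := fun n => by
    rw [hk]
    refine Measurable.indicator ?_ ((hA n).prod (hA n))
    have := hU n
    fun_prop
  have hlimk : ∀ᵐ x ∂μ, ∀ᵐ y ∂μ, Filter.liminf (fun n => k n (x, y)) Filter.atTop =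
      ENNReal.ofReal ((u x - u y) ^ 2) := by
    filter_upwards [hlim, hev] with x hx1 hx2
    filter_upwards [hlim, hev] with y hy1 hy2
    refine Filter.Tendsto.liminf_eq ?_
    have t : Filter.Tendsto (fun n => ENNReal.ofReal ((U n x - U n y) ^ 2)) Filter.atTop
        (nhds (ENNReal.ofReal ((u x - u y) ^ 2))) :=
      ENNReal.tendsto_ofReal ((hx1.sub hy1).pow 2)
    refine t.congr' ?_
    filter_upwards [hx2, hy2] with n h1 h2
    rw [hk]
    simp [h1, h2]
  have hliminf : Measurable fun p => Filter.liminf (fun n => k n p) Filter.atTop :=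
    Measurable.liminf hkm
  have heq : (fun x => ∫⁻ y, Filter.liminf (fun n => k n (x, y)) Filter.atTop ∂μ) =ᵐ[μ]
      fun x => ∫⁻ y, ENNReal.ofReal ((u x - u y) ^ 2) ∂μ := by
    filter_upwards [hlimk] with x hx
    exact lintegral_congr_ae hx
  refine ⟨(hliminf.lintegral_prod_right').aemeasurable.congr heq, ?_⟩
  rw [← lintegral_congr_ae heq]
  calc ∫⁻ x, ∫⁻ y, Filter.liminf (fun n => k n (x, y)) Filter.atTop ∂μ ∂μ
      ≤ ∫⁻ x, Filter.liminf (fun n => ∫⁻ y, k n (x, y) ∂μ) Filter.atTop ∂μ :=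
        lintegral_mono fun x => lintegral_liminf_le fun n => (hkm n).comp (by fun_prop)
    _ ≤ Filter.liminf (fun n => ∫⁻ x, ∫⁻ y, k n (x, y) ∂μ ∂μ) Filter.atTop :=
        lintegral_liminf_le fun n => (hkm n).lintegral_prod_right'
    _ ≤ M := by
        refine Filter.liminf_le_of_le (by isBoundedDefault) fun b hb => ?_
        obtain ⟨n, hn⟩ := hb.exists
        refine hn.trans (le_trans (le_of_eq ?_) (hM n))
        rw [← lintegral_indicator (hA n)]
        refine lintegral_congr fun x => ?_
        by_cases hx : x ∈ A n
        · rw [Set.indicator_of_mem hx, ← lintegral_indicator (hA n)]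
          refine lintegral_congr fun y => ?_
          rw [hk]
          by_cases hy : y ∈ A n <;> simp [hx, hy]
        · rw [Set.indicator_of_notMem hx]
          simp [hk, hx]

/-- The Poincaré inequality on bounded convex domains with a constant that does not depend on the
dimension. -/
theorem exists_integral_sub_sq_le_of_hasWeakDeriv {d : ℕ}
    {Ω : Set (EuclideanSpace ℝ (Fin d))} (hΩ : IsOpen Ω) (hc : Convex ℝ Ω)
    (hne : Ω.Nonempty) (hb : Bornology.IsBounded Ω)
    {u : EuclideanSpace ℝ (Fin d) → ℝ} {g : Fin d → EuclideanSpace ℝ (Fin d) → ℝ}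
    (hu : IntegrableOn u Ω) (hg : ∀ i, MemLp (g i) 2 (volume.restrict Ω))
    (h : ∀ i, HasWeakDeriv Ω (fun _ : Fin 1 => i) u (g i)) :
    ∃ a : ℝ, ∫ x in Ω, (u x - a) ^ 2 ≤
      16 * Real.exp 1 * Metric.diam Ω ^ 2 * ∑ i, ∫ x in Ω, g i x ^ 2 := by
  obtain ⟨x₀, hx₀⟩ := hne
  -- Zero diameter means that `Ω` is a single point; the smooth inequality needs a positive radius.
  rcases (Metric.diam_nonneg (s := Ω)).eq_or_lt with hD | hD
  · refine ⟨u x₀, ?_⟩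
    rw [← hD]
    have : ∫ x in Ω, (u x - u x₀) ^ 2 = ∫ x in Ω, (0 : ℝ) := by
      refine setIntegral_congr_fun hΩ.measurableSet fun x hx => ?_
      have : dist x x₀ ≤ 0 := hD ▸ Metric.dist_le_diam_of_mem hb hx hx₀
      simp [dist_le_zero.1 this]
    simp [this]
  have hΩD : Ω ⊆ Metric.closedBall x₀ (Metric.diam Ω) := fun x hx =>
    Metric.dist_le_diam_of_mem hb hx hx₀
  have hfin : IsFiniteMeasure (volume.restrict Ω) := ⟨by simpa using hb.measure_lt_top⟩
  have hui : Integrable (Ω.indicator u) := hu.integrable_indicator hΩ.measurableSet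
  have hpos : volume Ω ≠ 0 := (hΩ.measure_pos _ ⟨x₀, hx₀⟩).ne'
  -- The fixed ratio two of outer to inner radius gives almost everywhere convergence for merely
  -- integrable `u`.
  let φ : ℕ → ContDiffBump (0 : EuclideanSpace ℝ (Fin d)) := fun n =>
    ⟨1 / ((n : ℝ) + 1) / 2, 1 / ((n : ℝ) + 1), by positivity, half_lt_self (by positivity)⟩
  have hφ : Filter.Tendsto (fun n => (φ n).rOut) Filter.atTop (nhds 0) :=
    tendsto_one_div_add_atTop_nhds_zero_nat
  set A : ℕ → Set (EuclideanSpace ℝ (Fin d)) := fun n => {x | Metric.closedBall x (φ n).rOut ⊆ Ω}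
    with hA
  have hAm : ∀ n, MeasurableSet (A n) := fun n =>
    (isOpen_setOf_closedBall_subset hΩ (φ n).rOut).measurableSet
  have hAΩ : ∀ n, A n ⊆ Ω := fun n x hx => hx (Metric.mem_closedBall_self (φ n).rOut_pos.le)
  set U : ℕ → EuclideanSpace ℝ (Fin d) → ℝ := fun n =>
    (φ n).normed volume ⋆[ContinuousLinearMap.lsmul ℝ ℝ, volume] Ω.indicator u with hU
  have hUs : ∀ n, Continuous (U n) := fun n =>
    ((φ n).hasCompactSupport_normed.contDiff_convolution_left (n := 0) _
    (φ n).contDiff_normed hui.locallyIntegrable).continuous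
  have hlim : ∀ᵐ x ∂(volume.restrict Ω),
      Filter.Tendsto (fun n => U n x) Filter.atTop (nhds (u x)) := by
    have := ContDiffBump.ae_convolution_tendsto_right_of_locallyIntegrable (φ := φ) (K := 2) hφ
      (.of_forall fun n => le_of_eq (by simp only [φ]; ring)) hui.locallyIntegrable
    filter_upwards [ae_restrict_of_ae this, ae_restrict_mem hΩ.measurableSet] with x hx hxΩ
    rwa [Set.indicator_of_mem hxΩ] at hx
  have hev : ∀ᵐ x ∂(volume.restrict Ω), ∀ᶠ n in Filter.atTop, x ∈ A n := by
    filter_upwards [ae_restrict_mem hΩ.measurableSet] with x hx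
    obtain ⟨ε, hε, hεΩ⟩ := Metric.isOpen_iff.1 hΩ x hx
    filter_upwards [hφ.eventually_lt_const hε] with n hn
    exact (Metric.closedBall_subset_ball hn).trans hεΩ
  set S := ∑ i, ∫ x in Ω, g i x ^ 2 with hS
  have hS0 : 0 ≤ S := Finset.sum_nonneg fun i _ => integral_nonneg fun x => sq_nonneg _
  set M := 4 * Real.exp 1 * Metric.diam Ω ^ 2 * S with hM
  have hM0 : 0 ≤ M := by positivity
  have hbound : ∀ n, ∫⁻ x in A n, ∫⁻ y in A n, ENNReal.ofReal ((U n x - U n y) ^ 2)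
      ∂(volume.restrict Ω) ∂(volume.restrict Ω) ≤ 4 * ENNReal.ofReal M * volume Ω := by
    intro n
    obtain ⟨a, ha⟩ := exists_integral_normed_convolution_sub_sq_le hΩ hc hD hΩD hu hg h (φ n)
    rw [Measure.restrict_restrict_of_subset (hAΩ n)]
    have hcont : Continuous fun x => (U n x - a) ^ 2 := by
      have := hUs n
      fun_prop
    have := lintegral_lintegral_sub_sq_le (μ := volume.restrict (A n)) (hUs n).measurable a
      (M := ENNReal.ofReal M) (by
        rw [← ofReal_integral_eq_lintegral_ofReal
          ((hcont.continuousOn.integrableOn_compact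
            (isCompact_closedBall x₀ (Metric.diam Ω))).mono_set ((hAΩ n).trans hΩD))
          (.of_forall fun x => sq_nonneg _)]
        exact ENNReal.ofReal_le_ofReal ha)
    refine this.trans ?_
    rw [Measure.restrict_apply_univ]
    gcongr
    exact hAΩ n
  obtain ⟨hmeas, hle⟩ := lintegral_lintegral_sub_sq_le_of_tendsto hAm
    (fun n => (hUs n).measurable) hlim hev hbound
  -- Some `y` has inner integral at most the average over `Ω`, so `u y` can serve as the constant;
  -- the factor 4 from doubling turns `4e` into `16e`.
  obtain ⟨y, hy⟩ := exists_le_laverage (by simpa using hpos) hmeas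
  refine ⟨u y, ?_⟩
  have hy2 : ∫⁻ x in Ω, ENNReal.ofReal ((u x - u y) ^ 2) ≤ ENNReal.ofReal (4 * M) := by
    calc ∫⁻ x in Ω, ENNReal.ofReal ((u x - u y) ^ 2)
        = ∫⁻ x in Ω, ENNReal.ofReal ((u y - u x) ^ 2) := by
          refine lintegral_congr fun x => ?_
          congr 1
          ring
      _ ≤ _ := hy
      _ ≤ (4 * ENNReal.ofReal M * volume Ω) / volume Ω := by
          rw [laverage_eq, Measure.restrict_apply_univ]
          gcongr
      _ = ENNReal.ofReal (4 * M) := by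
          rw [ENNReal.mul_div_cancel_right hpos hb.measure_lt_top.ne,
            ENNReal.ofReal_mul (p := 4) (by norm_num), ENNReal.ofReal_ofNat]
  have hsm : AEStronglyMeasurable u (volume.restrict Ω) := hu.aestronglyMeasurable
  rw [integral_eq_lintegral_of_nonneg_ae (.of_forall fun x => sq_nonneg _)
    ((show AEStronglyMeasurable (fun x => u x - u y) (volume.restrict Ω) from
      hsm.sub aestronglyMeasurable_const).pow 2)]
  refine ENNReal.toReal_le_of_le_ofReal (by positivity) (hy2.trans (le_of_eq ?_))
  congr 1
  rw [hM]
  ring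

/-! ### Calculus of weak derivatives and the seminorms -/

theorem HasWeakDeriv.weakDeriv {d : ℕ} {Ω : Set (EuclideanSpace ℝ (Fin d))} {k : ℕ}
    {s : Fin k → Fin d} {v g : EuclideanSpace ℝ (Fin d) → ℝ} (h : HasWeakDeriv Ω s v g) :
    HasWeakDeriv Ω s v (weakDeriv Ω s v) := by
  have : ∃ g, HasWeakDeriv Ω s v g := ⟨g, h⟩
  unfold _root_.weakDeriv
  rw [dif_pos this]
  exact this.choose_spec

theorem HasWeakDeriv.integral_weakDeriv_sq {d : ℕ} {Ω : Set (EuclideanSpace ℝ (Fin d))}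
    (hΩ : IsOpen Ω) {k : ℕ} {s : Fin k → Fin d} {v g : EuclideanSpace ℝ (Fin d) → ℝ}
    (h : HasWeakDeriv Ω s v g) : ∫ x in Ω, _root_.weakDeriv Ω s v x ^ 2 = ∫ x in Ω, g x ^ 2 := by
  refine integral_congr_ae ?_
  filter_upwards [h.weakDeriv.ae_eq hΩ h] with x hx
  rw [hx]

theorem hasWeakDeriv_zero {d : ℕ} {Ω : Set (EuclideanSpace ℝ (Fin d))} (s : Fin 0 → Fin d)
    {v : EuclideanSpace ℝ (Fin d) → ℝ} (hv : LocallyIntegrableOn v Ω volume) :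
    HasWeakDeriv Ω s v v :=
  ⟨hv, hv, fun φ _ _ _ => by simp⟩

theorem integrableOn_mul_of_tsupport_subset {d : ℕ} {Ω : Set (EuclideanSpace ℝ (Fin d))}
    {v ψ : EuclideanSpace ℝ (Fin d) → ℝ} (hv : LocallyIntegrableOn v Ω volume)
    (hψ : Continuous ψ) (hc : HasCompactSupport ψ) (hs : tsupport ψ ⊆ Ω) :
    IntegrableOn (fun x => v x * ψ x) Ω := by
  have h1 := (hv.integrableOn_compact_subset hs hc).mul_continuousOn hψ.continuousOn hc
  refine ((integrableOn_iff_integrable_of_support_subset ?_).1 h1).integrableOn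
  intro x hx
  exact subset_tsupport ψ fun h0 => hx (by simp [h0])

theorem HasWeakDeriv.sub_affine {d : ℕ} {Ω : Set (EuclideanSpace ℝ (Fin d))}
    {v g : EuclideanSpace ℝ (Fin d) → ℝ} {i : Fin d}
    (h : HasWeakDeriv Ω (fun _ : Fin 1 => i) v g) (l : EuclideanSpace ℝ (Fin d) →L[ℝ] ℝ) (b : ℝ) :
    HasWeakDeriv Ω (fun _ : Fin 1 => i) (fun x => v x - (l x + b))
      (fun x => g x - l (EuclideanSpace.single i (1 : ℝ))) := by
  have hq : Continuous fun x => l x + b := by fun_prop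
  have hqi : LocallyIntegrableOn (fun x => l x + b) Ω volume :=
    hq.locallyIntegrable.locallyIntegrableOn _
  have hci : LocallyIntegrableOn
      (fun _ : EuclideanSpace ℝ (Fin d) => l (EuclideanSpace.single i (1 : ℝ))) Ω volume :=
    continuous_const.locallyIntegrable.locallyIntegrableOn _
  refine ⟨h.1.sub hqi, h.2.1.sub hci, fun φ hφ hc hs => ?_⟩
  have key := h.2.2 φ hφ hc hs
  simp only [iteratedFDeriv_one_apply, pow_one, neg_mul, one_mul] at key ⊢
  obtain ⟨ψ, hψ⟩ : ∃ ψ : EuclideanSpace ℝ (Fin d) → ℝ,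
    ψ = fun x => fderiv ℝ φ x (EuclideanSpace.single i (1 : ℝ)) := ⟨_, rfl⟩
  have hψx : ∀ x, fderiv ℝ φ x (EuclideanSpace.single i (1 : ℝ)) = ψ x := fun x => by rw [hψ]
  have hψc : Continuous ψ := by
    have := hφ.continuous_fderiv (by simp)
    rw [hψ]
    fun_prop
  have hψs : HasCompactSupport ψ := hψ ▸ hc.fderiv_apply (𝕜 := ℝ) _
  have hψt : tsupport ψ ⊆ Ω := (hψ ▸ tsupport_fderiv_apply_subset ℝ _).trans hs
  have ibp := integral_mul_fderiv_eq_neg_fderiv_mul_of_integrable (μ := volume) (𝕜 := ℝ)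
    (f := fun x => l x + b) (g := φ) (v := EuclideanSpace.single i (1 : ℝ))
    (by
      simp only [fderiv_add_const, ContinuousLinearMap.fderiv]
      exact (continuous_const.mul hφ.continuous).integrable_of_hasCompactSupport hc.mul_left)
    (by
      simp only [hψx]
      exact (hq.mul hψc).integrable_of_hasCompactSupport hψs.mul_left)
    ((hq.mul hφ.continuous).integrable_of_hasCompactSupport hc.mul_left)
    (fun x _ => by fun_prop) (fun x _ => hφ.differentiable (by simp) x)
  simp only [fderiv_add_const, ContinuousLinearMap.fderiv, hψx] at ibp key ⊢
  have r : ∀ w f : EuclideanSpace ℝ (Fin d) → ℝ, tsupport f ⊆ Ω →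
      ∫ x in Ω, w x * f x = ∫ x, w x * f x := fun w f hf =>
    setIntegral_eq_integral_of_forall_compl_eq_zero fun x hx => by
      rw [image_eq_zero_of_notMem_tsupport fun h => hx (hf h), mul_zero]
  simp only [sub_mul]
  rw [integral_sub (integrableOn_mul_of_tsupport_subset h.1 hψc hψs hψt)
      (integrableOn_mul_of_tsupport_subset hqi hψc hψs hψt),
    integral_sub (integrableOn_mul_of_tsupport_subset h.2.1 hφ.continuous hc hs)
      (integrableOn_mul_of_tsupport_subset hci hφ.continuous hc hs), key,
    r (fun x => l x + b) ψ hψt, r (fun _ => l (EuclideanSpace.single i (1 : ℝ))) φ hs, ibp]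
  ring

theorem iteratedFDeriv_two_single_apply {d : ℕ} (φ : EuclideanSpace ℝ (Fin d) → ℝ)
    (x : EuclideanSpace ℝ (Fin d)) (i j : Fin d) :
    iteratedFDeriv ℝ 2 φ x (fun m => EuclideanSpace.single (![i, j] m) (1 : ℝ)) =
      fderiv ℝ (fderiv ℝ φ) x (EuclideanSpace.single i (1 : ℝ))
        (EuclideanSpace.single j (1 : ℝ)) := by
  simp [iteratedFDeriv_two_apply]

theorem HasWeakDeriv.swap {d : ℕ} {Ω : Set (EuclideanSpace ℝ (Fin d))}
    {v g : EuclideanSpace ℝ (Fin d) → ℝ} {i j : Fin d} (h : HasWeakDeriv Ω ![i, j] v g) :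
    HasWeakDeriv Ω ![j, i] v g := by
  refine ⟨h.1, h.2.1, fun φ hφ hc hs => ?_⟩
  rw [← h.2.2 φ hφ hc hs]
  refine integral_congr_ae (.of_forall fun x => ?_)
  simp only [iteratedFDeriv_two_single_apply]
  rw [((contDiff_infty.1 hφ 2).contDiffAt.isSymmSndFDerivAt (by simp)).eq]

/-- Test the first-order identity with `∂_j φ` and compare with the second-order identity for `φ`.
-/
theorem HasWeakDeriv.of_two {d : ℕ} {Ω : Set (EuclideanSpace ℝ (Fin d))}
    {v g G : EuclideanSpace ℝ (Fin d) → ℝ} {i j : Fin d}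
    (h : HasWeakDeriv Ω (fun _ : Fin 1 => i) v g) (h2 : HasWeakDeriv Ω ![i, j] v G) :
    HasWeakDeriv Ω (fun _ : Fin 1 => j) g G := by
  refine ⟨h.2.1, h2.2.1, fun φ hφ hc hs => ?_⟩
  have hd : ContDiff ℝ ∞ (fderiv ℝ φ) := hφ.fderiv_right (by simp)
  have k1 := h.2.2 (fun x => fderiv ℝ φ x (EuclideanSpace.single j (1 : ℝ)))
    (hd.clm_apply contDiff_const) (hc.fderiv_apply (𝕜 := ℝ) _)
    ((tsupport_fderiv_apply_subset ℝ _).trans hs)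
  have k2 := h2.2.2 φ hφ hc hs
  have e : ∀ x, fderiv ℝ (fun x => fderiv ℝ φ x (EuclideanSpace.single j (1 : ℝ))) x
      (EuclideanSpace.single i (1 : ℝ)) =
      fderiv ℝ (fderiv ℝ φ) x (EuclideanSpace.single i (1 : ℝ))
        (EuclideanSpace.single j (1 : ℝ)) := by
    intro x
    rw [fderiv_clm_apply ((hd.differentiable (by simp)) x) (by fun_prop)]
    simp
  simp only [iteratedFDeriv_two_single_apply] at k2
  simp only [iteratedFDeriv_one_apply, e] at k1 ⊢
  rw [k2] at k1
  linarith

theorem sobolevSeminorm_zero_eq {d : ℕ} {Ω : Set (EuclideanSpace ℝ (Fin d))} (hΩ : IsOpen Ω)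
    {v : EuclideanSpace ℝ (Fin d) → ℝ} (hv : LocallyIntegrableOn v Ω volume) :
    sobolevSeminorm Ω 0 v = √(∫ x in Ω, v x ^ 2) := by
  unfold sobolevSeminorm
  congr 1
  rw [Finset.filter_true_of_mem fun s _ => Subsingleton.monotone s, Fintype.sum_unique,
    (hasWeakDeriv_zero _ hv).integral_weakDeriv_sq hΩ]

theorem sobolevSeminorm_one_eq {d : ℕ} {Ω : Set (EuclideanSpace ℝ (Fin d))} (hΩ : IsOpen Ω)
    {v : EuclideanSpace ℝ (Fin d) → ℝ} {g : Fin d → EuclideanSpace ℝ (Fin d) → ℝ}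
    (h : ∀ i, HasWeakDeriv Ω (fun _ : Fin 1 => i) v (g i)) :
    sobolevSeminorm Ω 1 v = √(∑ i, ∫ x in Ω, g i x ^ 2) := by
  unfold sobolevSeminorm
  congr 1
  rw [Finset.filter_true_of_mem fun s _ => Subsingleton.monotone s]
  refine Fintype.sum_equiv (Equiv.funUnique (Fin 1) (Fin d)) _ _ fun s => ?_
  have hs : s = fun _ => s 0 := by
    ext m
    rw [Subsingleton.elim m 0]
  have := (h (s 0)).integral_weakDeriv_sq hΩ
  rw [← hs] at this
  simpa using this

theorem sobolevSeminorm_two_eq {d : ℕ} (Ω : Set (EuclideanSpace ℝ (Fin d)))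
    (v : EuclideanSpace ℝ (Fin d) → ℝ) :
    sobolevSeminorm Ω 2 v =
      √(∑ i, ∑ j, if i ≤ j then ∫ x in Ω, weakDeriv Ω ![i, j] v x ^ 2 else 0) := by
  unfold sobolevSeminorm
  congr 1
  rw [Finset.sum_filter, ← Fintype.sum_prod_type']
  refine Fintype.sum_equiv (finTwoArrowEquiv (Fin d)) _ _ fun s => ?_
  have h1 : Monotone s ↔ s 0 ≤ s 1 := by
    rw [Fin.monotone_iff_le_succ]
    simp
  have h2 : ![s 0, s 1] = s := by
    ext m
    fin_cases m <;> rfl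
  simp [h1, h2]

/-- The seminorm counts each mixed derivative once, while summing over the gradients of all first
derivatives counts it twice. -/
theorem sum_sum_min_max_le {ι : Type*} [Fintype ι] [LinearOrder ι] {F : ι → ι → ℝ}
    (hF : ∀ i j, 0 ≤ F i j) :
    ∑ i, ∑ j, F (min i j) (max i j) ≤ 2 * ∑ i, ∑ j, if i ≤ j then F i j else 0 := by
  have e : ∑ i, ∑ j, (if j ≤ i then F j i else 0) = ∑ i, ∑ j, if i ≤ j then F i j else 0 :=
    Finset.sum_comm
  rw [two_mul]
  nth_rw 2 [← e]
  simp only [← Finset.sum_add_distrib]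
  refine Finset.sum_le_sum fun i _ => Finset.sum_le_sum fun j _ => ?_
  rcases le_total i j with h | h
  · rw [min_eq_left h, max_eq_right h, if_pos h]
    refine le_add_of_nonneg_right ?_
    split_ifs
    exacts [hF _ _, le_rfl]
  · rw [min_eq_right h, max_eq_left h, if_pos h]
    refine le_add_of_nonneg_left ?_
    split_ifs
    exacts [hF _ _, le_rfl]

theorem MemH.memLp {d : ℕ} {Ω : Set (EuclideanSpace ℝ (Fin d))} (hΩ : IsOpen Ω) {k : ℕ}
    {v : EuclideanSpace ℝ (Fin d) → ℝ} (h : MemH Ω k v) : MemLp v 2 (volume.restrict Ω) := by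
  obtain ⟨g, hg, hg2⟩ := h 0 k.zero_le Fin.elim0
  exact (memLp_congr_ae ((hasWeakDeriv_zero _ hg.1).ae_eq hΩ hg)).2 hg2

theorem MemH.hasWeakDeriv_weakDeriv {d : ℕ} {Ω : Set (EuclideanSpace ℝ (Fin d))} {k : ℕ}
    {v : EuclideanSpace ℝ (Fin d) → ℝ} (h : MemH Ω k v) {j : ℕ} (hj : j ≤ k) (s : Fin j → Fin d) :
    HasWeakDeriv Ω s v (weakDeriv Ω s v) := by
  obtain ⟨g, hg, -⟩ := h j hj s
  exact hg.weakDeriv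

theorem MemH.memLp_weakDeriv {d : ℕ} {Ω : Set (EuclideanSpace ℝ (Fin d))} (hΩ : IsOpen Ω) {k : ℕ}
    {v : EuclideanSpace ℝ (Fin d) → ℝ} (h : MemH Ω k v) {j : ℕ} (hj : j ≤ k) (s : Fin j → Fin d) :
    MemLp (weakDeriv Ω s v) 2 (volume.restrict Ω) := by
  obtain ⟨g, hg, hg2⟩ := h j hj s
  exact (memLp_congr_ae (hg.weakDeriv.ae_eq hΩ hg)).2 hg2

/-! ### Approximation by an affine function -/

/-- On a bounded convex domain, one affine function approximates `v` in `L²` and its gradient in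
`L²`, with constants that do not depend on the dimension. -/
theorem exists_affineMap_sobolevSeminorm_le {d : ℕ} {Ω : Set (EuclideanSpace ℝ (Fin d))}
    (hΩ : IsOpen Ω) (hc : Convex ℝ Ω) (hb : Bornology.IsBounded Ω) (hne : Ω.Nonempty)
    {v : EuclideanSpace ℝ (Fin d) → ℝ} (hv : MemH Ω 2 v) :
    ∃ p : EuclideanSpace ℝ (Fin d) →ᵃ[ℝ] ℝ, ∀ j ≤ 1, sobolevSeminorm Ω j (fun x => v x - p x) ≤
      32 * Real.exp 1 * Metric.diam Ω ^ (2 - j) * sobolevSeminorm Ω 2 v := by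
  have hfin : IsFiniteMeasure (volume.restrict Ω) := ⟨by simpa using hb.measure_lt_top⟩
  obtain ⟨g, hg⟩ : ∃ g : Fin d → EuclideanSpace ℝ (Fin d) → ℝ,
    g = fun i => weakDeriv Ω (fun _ : Fin 1 => i) v := ⟨_, rfl⟩
  have hgd : ∀ i, HasWeakDeriv Ω (fun _ : Fin 1 => i) v (g i) := fun i => by
    rw [hg]; exact hv.hasWeakDeriv_weakDeriv (by norm_num) _
  have hgL : ∀ i, MemLp (g i) 2 (volume.restrict Ω) := fun i => by
    rw [hg]; exact hv.memLp_weakDeriv hΩ (by norm_num) _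
  -- The indices are sorted so that the representatives are those occurring in the seminorm.
  have hGd : ∀ i j, HasWeakDeriv Ω ![i, j] v (weakDeriv Ω ![min i j, max i j] v) := fun i j => by
    have := hv.hasWeakDeriv_weakDeriv le_rfl ![min i j, max i j]
    rcases le_total i j with h | h
    · simpa only [min_eq_left h, max_eq_right h] using this
    · simp only [min_eq_right h, max_eq_left h] at this ⊢
      exact this.swap
  have p1 : ∀ i, ∃ a : ℝ, ∫ x in Ω, (g i x - a) ^ 2 ≤ 16 * Real.exp 1 * Metric.diam Ω ^ 2 *
      ∑ j, ∫ x in Ω, weakDeriv Ω ![min i j, max i j] v x ^ 2 := fun i =>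
    exists_integral_sub_sq_le_of_hasWeakDeriv hΩ hc hne hb ((hgL i).integrable (by norm_num))
      (fun j => hv.memLp_weakDeriv hΩ le_rfl _) fun j => (hgd i).of_two (hGd i j)
  choose a ha using p1
  obtain ⟨l, hl⟩ : ∃ l : EuclideanSpace ℝ (Fin d) →L[ℝ] ℝ,
      ∀ i, l (EuclideanSpace.single i (1 : ℝ)) = a i :=
    ⟨∑ i, a i • EuclideanSpace.proj i, fun i => by simp⟩
  have hsub : ∀ b i, HasWeakDeriv Ω (fun _ : Fin 1 => i) (fun x => v x - (l x + b))
      (fun x => g i x - a i) := fun b i => by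
    rw [← hl i]; exact (hgd i).sub_affine l b
  have hl0 : Continuous fun x => l x + 0 := by fun_prop
  have hli : IntegrableOn (fun x => l x + 0) Ω :=
    (hl0.continuousOn.integrableOn_compact hb.isCompact_closure).mono_set subset_closure
  obtain ⟨b, hb2⟩ := exists_integral_sub_sq_le_of_hasWeakDeriv hΩ hc hne hb
    (((hv.memLp hΩ).integrable (by norm_num)).sub hli)
    (fun i => (hgL i).sub (memLp_const (a i))) (hsub 0)
  set D := Metric.diam Ω with hD
  have hD0 : 0 ≤ D := Metric.diam_nonneg
  set T := ∑ i, ∑ j, if i ≤ j then ∫ x in Ω, weakDeriv Ω ![i, j] v x ^ 2 else 0 with hT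
  have hT0 : 0 ≤ T := Finset.sum_nonneg fun i _ => Finset.sum_nonneg fun j _ => by
    split_ifs
    exacts [integral_nonneg fun x => sq_nonneg _, le_rfl]
  have q1 : ∑ i, ∫ x in Ω, (g i x - a i) ^ 2 ≤ 32 * Real.exp 1 * D ^ 2 * T := by
    calc ∑ i, ∫ x in Ω, (g i x - a i) ^ 2 ≤ ∑ i, 16 * Real.exp 1 * D ^ 2 *
          ∑ j, ∫ x in Ω, weakDeriv Ω ![min i j, max i j] v x ^ 2 :=
          Finset.sum_le_sum fun i _ => ha i
      _ ≤ 16 * Real.exp 1 * D ^ 2 * (2 * T) := by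
          rw [← Finset.mul_sum]
          gcongr
          exact sum_sum_min_max_le (F := fun i j => ∫ x in Ω, weakDeriv Ω ![i, j] v x ^ 2)
            fun i j => integral_nonneg fun x => sq_nonneg _
      _ = _ := by ring
  have he : 1 ≤ Real.exp 1 := Real.one_le_exp (by norm_num)
  have sqrt_le : ∀ X c : ℝ, 0 ≤ c → X ≤ c ^ 2 * T → √X ≤ c * √T := fun X c hc hX => by
    calc √X ≤ √(c ^ 2 * T) := Real.sqrt_le_sqrt hX
      _ = c * √T := by rw [Real.sqrt_mul (sq_nonneg c), Real.sqrt_sq hc]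
  obtain ⟨p, hp'⟩ : ∃ p : EuclideanSpace ℝ (Fin d) →ᵃ[ℝ] ℝ, ∀ x, p x = l x + b :=
    ⟨l.toLinearMap.toAffineMap + AffineMap.const ℝ _ b, fun x => by simp⟩
  refine ⟨p, fun j hj => ?_⟩
  have hp : (fun x => v x - p x) = fun x => v x - (l x + b) := funext fun x => by rw [hp']
  rw [hp, sobolevSeminorm_two_eq, ← hT]
  interval_cases j
  · have hloc : LocallyIntegrableOn (fun x => v x - (l x + b)) Ω volume :=
      (hv.hasWeakDeriv_weakDeriv (Nat.zero_le 2) Fin.elim0).1.sub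
        ((show Continuous fun x => l x + b by fun_prop).locallyIntegrable.locallyIntegrableOn _)
    rw [sobolevSeminorm_zero_eq hΩ hloc]
    refine sqrt_le _ _ (by positivity) ?_
    calc ∫ x in Ω, (v x - (l x + b)) ^ 2 = ∫ x in Ω, (v x - (l x + 0) - b) ^ 2 := by
          refine integral_congr_ae (.of_forall fun x => ?_)
          ring
      _ ≤ 16 * Real.exp 1 * D ^ 2 * (32 * Real.exp 1 * D ^ 2 * T) :=
          -- Poincaré for `v - l` followed by Poincaré for its gradient; enlarging 16 to 32 makes
          -- the constant a perfect square.
          hb2.trans (mul_le_mul_of_nonneg_left q1 (by positivity))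
      _ ≤ 32 * Real.exp 1 * D ^ 2 * (32 * Real.exp 1 * D ^ 2 * T) := by gcongr; norm_num
      _ = _ := by ring
  · rw [sobolevSeminorm_one_eq hΩ (hsub b)]
    refine sqrt_le _ _ (by positivity) (q1.trans ?_)
    have : 1 ≤ 32 * Real.exp 1 := by linarith
    calc 32 * Real.exp 1 * D ^ 2 * T ≤ (32 * Real.exp 1) ^ 2 * D ^ 2 * T := by
          gcongr
          exact le_self_pow₀ this (by norm_num)
      _ = _ := by ring

theorem mainTheorem10 :
    ∃ C : ℝ, 0 < C ∧
      ∀ (d : ℕ) (Ω : Set (EuclideanSpace ℝ (Fin d))),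
        IsOpen Ω → Convex ℝ Ω → Bornology.IsBounded Ω → Ω.Nonempty →
          ∀ v : EuclideanSpace ℝ (Fin d) → ℝ, MemH Ω 2 v →
            ∀ j : ℕ, j ≤ 1 →
              (⨅ p : EuclideanSpace ℝ (Fin d) →ᵃ[ℝ] ℝ,
                  sobolevSeminorm Ω j (fun x => v x - p x)) ≤
                C * Metric.diam Ω ^ (2 - j) * sobolevSeminorm Ω 2 v := by
  refine ⟨32 * Real.exp 1, by positivity, fun d Ω hΩ hc hb hne v hv j hj => ?_⟩
  obtain ⟨p, hp⟩ := exists_affineMap_sobolevSeminorm_le hΩ hc hb hne hv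
  exact (ciInf_le ⟨0, by rintro _ ⟨q, rfl⟩; exact Real.sqrt_nonneg _⟩ p).trans (hp j hj)
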